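/- Let $S^3$ be the unit sphere in a four-dimensional Euclidean vector space, with the round metric $g$ and its Levi-Civita connection $\nabla$. Symmetric tensors $K_{\alpha\beta}$ on $S^3$ are smooth and are identified with symmetric endomorphism fields $K^\alpha{}_\beta=g^{\alpha\gamma}K_{\gamma\beta}$; round (square) brackets denote complete symmetrisation (antisymmetrisation) of indices. A symmetric tensor $K$ is a Killing tensor if $\nabla_{(\gamma}K_{\alpha\beta)}=0$. It is integrable if its Nijenhuis torsion $N^\alpha{}_{\beta\gamma}=K^\alpha{}_\delta\nabla_{[\gamma}K^\delta{}_{\beta]}+\nabla_\delta K^\alpha{}_{[\gamma}K^\delta{}_{\beta]}$ satisfies $$N^\delta{}_{[\beta\gamma}g_{\alpha]\delta}=0,\qquad N^\delta{}_{[\beta\gamma}K_{\alpha]\delta}=0,\qquad N^\delta{}_{[\beta\gamma}K_{\alpha]\varepsilon}K^\varepsilon{}_\delta=0.$$ A Stäckel system on $S^3$ is a three-dimensional real vector space of mutually commuting integrable Killing tensors. A special conformal Killing tensor is a symmetric tensor $L$ with $\nabla_\gamma L_{\alpha\beta}=\lambda_\alpha g_{\beta\gamma}+\lambda_\beta g_{\alpha\gamma}$,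 where $\lambda=\tfrac12\nabla\operatorname{tr}L$; a special Killing tensor is a Killing tensor of the form $K=L-(\operatorname{tr}L)g$ with $L$ a special conformal Killing tensor. Every Stäckel system $\mathcal S$ on $S^3$ contains a special Killing tensor $K$ that is not a constant multiple of $g$, and $K$ is unique up to multiplication with constants and addition of constant multiples of the metric: the special Killing tensors in $\mathcal S$ are exactly the tensors $aK+bg$ with $a,b\in\mathbb R$. -/

import Mathlib

open scoped Manifold ContDiff InnerProductSpace

noncomputable section

namespace RoundSphere

/-- The ambient Euclidean space of dimension four. -/
abbrev V : Type := EuclideanSpace ℝ (Fin 4)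

/-- The standard sphere `S³`: the unit sphere in `V`, with Mathlib's manifold structure.  The tangent
space at `x` is identified with the orthogonal complement `(ℝ ∙ x)ᗮ` of `x` in `V`, and the round metric
is the restriction of the scalar product of `V`. -/
abbrev S3 : Type := Metric.sphere (0 : V) 1

/-- The tangent space of `S³` at `x`, as a subspace of `V`. -/
abbrev tangent (x : S3) : Submodule ℝ V := (ℝ ∙ (x : V))ᗮ

/-- The orthogonal projection `P x` of `V` onto the tangent space of `S³` at `x`. -/
def P (x : S3) : V →L[ℝ] V := (tangent x).starProjection

/-- Fields of endomorphisms.  An endomorphism of the tangent space `tangent x` is represented by its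
extension to `V` that vanishes on the normal line `ℝ x`; see `IsSymmetricTensorField`. -/
abbrev Field : Type := S3 → V →L[ℝ] V

/-- `A` is a smooth symmetric tensor field on `S³`, regarded as a field of symmetric endomorphisms of
the tangent spaces.  (Symmetry of `A x` and `A x x = 0` imply that `A x` maps `V` into `tangent x`.)
The corresponding symmetric bilinear form on `tangent x` is `(v, w) ↦ ⟪A x v, w⟫`. -/
structure IsSymmetricTensorField (A : Field) : Prop where
  smooth : ContMDiff (𝓡 3) 𝓘(ℝ, V →L[ℝ] V) ∞ A
  symmetric : ∀ (x : S3) (v w : V), ⟪A x v, w⟫_ℝ = ⟪v, A x w⟫_ℝ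
  normal : ∀ x : S3, A x (x : V) = 0

/-- The metric of `S³`, as a field of endomorphisms: the identity of each tangent space. -/
def metric : Field := fun x => P x

/-- The trace of an endomorphism field.  As `A x` vanishes on the normal line and takes values in
`tangent x`, its trace on `V` is the trace of the endomorphism of the tangent space. -/
def tr (A : Field) : S3 → ℝ := fun x => LinearMap.trace ℝ V (A x : V →ₗ[ℝ] V)

section Derivative

variable {F : Type*} [NormedAddCommGroup F] [NormedSpace ℝ F]

/-- The extension of a function on `S³` to `V` that is constant along rays (and zero at the origin). -/
def radialExt (f : S3 → F) : V → F := fun y =>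
  Function.extend (Subtype.val : S3 → V) f 0 (‖y‖⁻¹ • y)

/-- The derivative of a differentiable function `f` on `S³` at `x` in the direction of a tangent vector
`v`. -/
def D (f : S3 → F) (x : S3) (v : V) : F := fderiv ℝ (radialExt f) (x : V) v

end Derivative

/-- The Levi-Civita covariant derivative `∇_v A` of an endomorphism field at `x` in the direction of a
tangent vector `v`.  The Levi-Civita connection of `S³ ⊂ V` on vector fields is `∇_v W = P x (D_v W)`;
since `(∇_v A) W = ∇_v (A W) - A (∇_v W)`, the endomorphism `∇_v A` of the tangent space is the
tangential part of `D_v A`. -/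
def nabla (A : Field) (x : S3) (v : V) : V →L[ℝ] V := P x ∘L D A x v ∘L P x

/-- Killing tensors: `∇_(γ K_αβ) = 0`.  As `∇ K` is symmetric in the indices of `K`, the complete
symmetrisation is the cyclic sum. -/
structure IsKillingTensor (K : Field) : Prop extends IsSymmetricTensorField K where
  killing : ∀ x : S3, ∀ u ∈ tangent x, ∀ v ∈ tangent x, ∀ w ∈ tangent x,
    ⟪nabla K x u v, w⟫_ℝ + ⟪nabla K x v w, u⟫_ℝ + ⟪nabla K x w u, v⟫_ℝ = 0

/-- The Nijenhuis torsion
`N^α_βγ = K^α_δ ∇_[γ K^δ_β] + ∇_δ K^α_[γ K^δ_β]`,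
where `v` fills the slot `β` and `w` fills the slot `γ`. -/
def nijenhuis (K : Field) (x : S3) (v w : V) : V :=
  (1 / 2 : ℝ) • (K x (nabla K x w v - nabla K x v w)
    + (nabla K x (K x v) w - nabla K x (K x w) v))

/-- The Nijenhuis integrability conditions
`N^δ_[βγ g_α]δ = 0`, `N^δ_[βγ K_α]δ = 0`, `N^δ_[βγ K_α]ε K^ε_δ = 0`.
As `N` is antisymmetric in its lower indices, complete antisymmetrisation is the cyclic sum. -/
structure IsIntegrable (K : Field) : Prop where
  first : ∀ x : S3, ∀ u ∈ tangent x, ∀ v ∈ tangent x, ∀ w ∈ tangent x,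
    ⟪nijenhuis K x u v, w⟫_ℝ + ⟪nijenhuis K x v w, u⟫_ℝ + ⟪nijenhuis K x w u, v⟫_ℝ = 0
  second : ∀ x : S3, ∀ u ∈ tangent x, ∀ v ∈ tangent x, ∀ w ∈ tangent x,
    ⟪nijenhuis K x u v, K x w⟫_ℝ + ⟪nijenhuis K x v w, K x u⟫_ℝ
      + ⟪nijenhuis K x w u, K x v⟫_ℝ = 0
  third : ∀ x : S3, ∀ u ∈ tangent x, ∀ v ∈ tangent x, ∀ w ∈ tangent x,
    ⟪nijenhuis K x u v, K x (K x w)⟫_ℝ + ⟪nijenhuis K x v w, K x (K x u)⟫_ℝ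
      + ⟪nijenhuis K x w u, K x (K x v)⟫_ℝ = 0

/-- Stäckel systems on the three-dimensional manifold `S³`: three-dimensional vector spaces of mutually
commuting integrable Killing tensors. -/
structure IsStaeckelSystem (S : Submodule ℝ Field) : Prop where
  dim : Module.finrank ℝ S = 3
  killing : ∀ K ∈ S, IsKillingTensor K
  integrable : ∀ K ∈ S, IsIntegrable K
  commute : ∀ K ∈ S, ∀ K' ∈ S, ∀ x : S3, K x ∘L K' x = K' x ∘L K x

/-- Special conformal Killing tensors: symmetric tensors that satisfy the Sinjukov equation
`∇_γ L_αβ = λ_α g_βγ + λ_β g_αγ` with `λ = ½ ∇ tr L`. -/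
structure IsSpecialConformalKillingTensor (L : Field) : Prop extends IsSymmetricTensorField L where
  sinjukov : ∀ x : S3, ∀ u ∈ tangent x, ∀ v ∈ tangent x, ∀ w ∈ tangent x,
    ⟪nabla L x u v, w⟫_ℝ
      = (1 / 2 : ℝ) * D (tr L) x v * ⟪w, u⟫_ℝ + (1 / 2 : ℝ) * D (tr L) x w * ⟪v, u⟫_ℝ

/-- Special Killing tensors: Killing tensors of the form `K = L - (tr L) g` with a special conformal
Killing tensor `L`. -/
def IsSpecialKillingTensor (K : Field) : Prop :=
  IsKillingTensor K ∧
    ∃ L : Field, IsSpecialConformalKillingTensor L ∧ ∀ x : S3, K x = L x - tr L x • metric x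

end RoundSphere

end

noncomputable section

namespace RoundSphere

open Matrix

/-! View the sphere as the unit quaternions. A Killing tensor is conserved along great circles,
which makes it symmetric in base point and direction; hence it is quadratic in the base point and
comes from an algebraic curvature tensor on four-space. On bivectors, split into self-dual and
anti-self-dual ones, this is a symmetric form with blocks `p`, `m`, `z`, and the Bianchi identity
says `tr p = tr m`. In the left-invariant frame at `x`, with `φ` the rotation of `x`, the tensor has
matrix `p + φᵀmφ + zφ + φᵀzᵀ`, and a similar matrix with changed signs describes its covariant
derivative. The torsion conditions become trace identities in `φ`; tested on the rotations of a
tetrahedron they show that `p` and `m` have the same power sums and that `pz = zm`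
(`Coeffs.Represents.integrable`).

The trace-free part of `p` is the self-dual Weyl part. Two commuting integrable Killing tensors have
dependent Weyl parts (`exists_traceFree_eq_zero`): some combination has a Weyl part of determinant
zero. If that is not already zero its eigenvalues are simple, so everything diagonalizes
simultaneously, and commutation forces the other self-dual block to be a combination of this one and
the identity.

If the Weyl part of an integrable tensor vanishes, `p` and `m` are the same scalar and `K` is `PAP +
⟪Ax, x⟫P` for a symmetric `A` on four-space, so the members of a Stäckel system of this kind are
special (`isSpecialKillingTensor_ofEndo`); conversely every special Killing tensor has zero Weyl
part (`IsSpecialKillingTensor.weyl_eq_zero`). If two such fields commute, `A`, `A'` and the identity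
are linearly dependent (`eq_smul_id_or_exists_eq_smul_add`).

It remains to count dimensions on `S` plus the metric. The Weyl map has rank at most one, so its
kernel has dimension at least two; by the last dependence it is spanned by the metric and one
further `K`. The sum therefore has dimension three and equals `S`. -/

/-- Real `3 × 3` matrices. -/
abbrev M3 : Type := Matrix (Fin 3) (Fin 3) ℝ

/-! ### Unit quaternions and rotations of three-space -/

/-- The rotation `a ↦ x a x⁻¹` of the imaginary quaternions, multiplied by `|x|²`. -/
def rot (a b c d : ℝ) : M3 :=
  !![a ^ 2 + b ^ 2 - c ^ 2 - d ^ 2, 2 * (b * c - a * d), 2 * (b * d + a * c);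
     2 * (b * c + a * d), a ^ 2 - b ^ 2 + c ^ 2 - d ^ 2, 2 * (c * d - a * b);
     2 * (b * d - a * c), 2 * (c * d + a * b), a ^ 2 - b ^ 2 - c ^ 2 + d ^ 2]

theorem rot_transpose_mul {a b c d : ℝ} (h : a ^ 2 + b ^ 2 + c ^ 2 + d ^ 2 = 1) :
    (rot a b c d)ᵀ * rot a b c d = 1 := by
  have key : (rot a b c d)ᵀ * rot a b c d =
      ((a ^ 2 + b ^ 2 + c ^ 2 + d ^ 2) ^ 2) • (1 : M3) := by
    ext i j
    fin_cases i <;> fin_cases j <;>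
      simp [rot, Matrix.mul_apply, Fin.sum_univ_three] <;> ring
  rw [key, h]; simp

theorem det_rot {a b c d : ℝ} (h : a ^ 2 + b ^ 2 + c ^ 2 + d ^ 2 = 1) :
    (rot a b c d).det = 1 := by
  have key : (rot a b c d).det = (a ^ 2 + b ^ 2 + c ^ 2 + d ^ 2) ^ 3 := by
    simp [rot, Matrix.det_fin_three]; ring
  rw [key, h]; simp

/-- `N` plays the role of `4 q qᵀ` for the sought quaternion `q`: the row of a positive diagonal
entry, suitably scaled, is `q` up to sign. -/
theorem exists_rot_of_pivot {A : M3} {N : Fin 4 → Fin 4 → ℝ} (a : Fin 4) (ha : 0 < N a a)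
    (hN : ∀ b c, N a b * N a c = N a a * N b c) (htr : ∑ b, N b b = 4)
    (hA : A = !![(N 0 0 + N 1 1 - N 2 2 - N 3 3) / 4, (N 1 2 - N 0 3) / 2, (N 1 3 + N 0 2) / 2;
      (N 1 2 + N 0 3) / 2, (N 0 0 - N 1 1 + N 2 2 - N 3 3) / 4, (N 2 3 - N 0 1) / 2;
      (N 1 3 - N 0 2) / 2, (N 2 3 + N 0 1) / 2, (N 0 0 - N 1 1 - N 2 2 + N 3 3) / 4]) :
    ∃ a b c d : ℝ, a ^ 2 + b ^ 2 + c ^ 2 + d ^ 2 = 1 ∧ A = rot a b c d := by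
  obtain ⟨s, hs⟩ : ∃ s : ℝ, s ^ 2 * N a a = 1 / 4 :=
    ⟨Real.sqrt (1 / (4 * N a a)), by rw [Real.sq_sqrt (by positivity)]; field_simp⟩
  have prod : ∀ b c, (s * N a b) * (s * N a c) = N b c / 4 := by
    intro b c
    linear_combination s ^ 2 * hN b c + N b c * hs
  refine ⟨s * N a 0, s * N a 1, s * N a 2, s * N a 3, ?_, ?_⟩
  · rw [Fin.sum_univ_four] at htr
    linear_combination prod 0 0 + prod 1 1 + prod 2 2 + prod 3 3 + htr / 4
  · rw [hA, rot]
    simp only [pow_two, prod]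
    ext i j
    fin_cases i <;> fin_cases j <;> simp <;> ring

/-- Every rotation of three-space comes from a unit quaternion. -/
theorem exists_rot {A : M3} (h : Aᵀ * A = 1) (hd : A.det = 1) :
    ∃ a b c d : ℝ, a ^ 2 + b ^ 2 + c ^ 2 + d ^ 2 = 1 ∧ A = rot a b c d := by
  have h' : A * Aᵀ = 1 := mul_eq_one_comm.mp h
  have hadj : A.adjugate = Aᵀ := by
    calc A.adjugate = (Aᵀ * A) * A.adjugate := by rw [h, one_mul]
      _ = Aᵀ := by rw [mul_assoc, mul_adjugate, hd, one_smul, mul_one]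
  rw [Matrix.adjugate_fin_three] at hadj
  obtain ⟨a00, a01, a02, a10, a11, a12, a20, a21, a22, rfl⟩ :
      ∃ a00 a01 a02 a10 a11 a12 a20 a21 a22, A = !![a00, a01, a02; a10, a11, a12; a20, a21, a22] :=
    ⟨_, _, _, _, _, _, _, _, _, A.eta_fin_three⟩
  have r := fun i j => congrFun (congrFun h i) j
  have r' := fun i j => congrFun (congrFun h' i) j
  have q := fun i j => congrFun (congrFun hadj i) j
  simp [Fin.forall_fin_succ, Matrix.mul_apply, Fin.sum_univ_three] at r r' q
  obtain ⟨⟨r1, r2, r3⟩, ⟨-, r4, r5⟩, -, -, r6⟩ := r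
  obtain ⟨⟨s1, s2, s3⟩, ⟨-, s4, s5⟩, -, -, s6⟩ := r'
  obtain ⟨⟨q1, q2, q3⟩, ⟨q4, q5, q6⟩, q7, q8, q9⟩ := q
  -- Inverting `rot`, these are the values `4 q_a q_b` for a unit quaternion `q`. The rank-one
  -- relations follow from orthogonality and from the adjugate being the transpose.
  let N : Fin 4 → Fin 4 → ℝ := !![1 + a00 + a11 + a22, a21 - a12, a02 - a20, a10 - a01;
    a21 - a12, 1 + a00 - a11 - a22, a01 + a10, a02 + a20;
    a02 - a20, a01 + a10, 1 - a00 + a11 - a22, a12 + a21;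
    a10 - a01, a02 + a20, a12 + a21, 1 - a00 - a11 + a22]
  have hN : ∀ a b c, N a b * N a c = N a a * N b c := by
    intro a b c
    fin_cases a <;> fin_cases b <;> fin_cases c <;> simp [N] <;> linarith
  have htr : ∑ b, N b b = 4 := by simp [N, Fin.sum_univ_four]; ring
  obtain ⟨a, ha⟩ : ∃ a, 0 < N a a := by
    by_contra! hc
    have := Finset.sum_nonpos (fun b (_ : b ∈ Finset.univ) => hc b)
    linarith
  refine exists_rot_of_pivot a ha (hN a) htr ?_
  ext i j
  fin_cases i <;> fin_cases j <;> simp [N] <;> ring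

/-! ### Isospectral symmetric matrices -/

/-- Newton's identities: equal power sums force equal characteristic polynomials, hence equal
eigenvalues. -/
theorem charpoly_fin_three (A : M3) : A.charpoly =
    Polynomial.X ^ 3 - Polynomial.C A.trace * Polynomial.X ^ 2
      + Polynomial.C ((A.trace ^ 2 - (A * A).trace) / 2) * Polynomial.X
      - Polynomial.C ((A.trace ^ 3 - 3 * A.trace * (A * A).trace + 2 * (A * A * A).trace) / 6) := by
  refine Polynomial.funext fun r => ?_
  rw [Matrix.eval_charpoly, Matrix.det_fin_three]
  simp [Matrix.trace_fin_three, Matrix.mul_apply, Fin.sum_univ_three]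
  ring

theorem exists_rotation_diagonalizing {A : M3} (hA : A.IsHermitian) :
    ∃ U : M3, Uᵀ * U = 1 ∧ U.det = 1 ∧ A = U * diagonal hA.eigenvalues * Uᵀ := by
  obtain ⟨U, hU, hAU⟩ : ∃ U : M3, Uᵀ * U = 1 ∧ A = U * diagonal hA.eigenvalues * Uᵀ := by
    refine ⟨hA.eigenvectorUnitary, ?_, ?_⟩
    · simpa [star_eq_conjTranspose] using (Unitary.mem_iff.mp hA.eigenvectorUnitary.2).1
    · simpa [Unitary.conjStarAlgAut_apply, star_eq_conjTranspose, Function.comp_def]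
        using hA.spectral_theorem
  have hd : U.det * U.det = 1 := by
    simpa [det_mul, det_transpose] using congrArg det hU
  rcases mul_self_eq_one_iff.mp hd with h | h
  · exact ⟨U, hU, h, hAU⟩
  -- The size is odd, so a change of sign makes the determinant positive without affecting the
  -- conjugation.
  · refine ⟨-U, by simpa using hU, ?_, by simpa using hAU⟩
    rw [det_neg, h]; norm_num

/-- Two symmetric matrices with the same power sums are diagonalized, with the same eigenvalues, by
rotations. -/
theorem exists_rotations_diagonalizing {A B : M3} (hA : A.IsSymm) (hB : B.IsSymm)
    (h1 : A.trace = B.trace) (h2 : (A * A).trace = (B * B).trace)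
    (h3 : (A * A * A).trace = (B * B * B).trace) :
    ∃ (w : Fin 3 → ℝ) (U W : M3), (Uᵀ * U = 1 ∧ U.det = 1) ∧ (Wᵀ * W = 1 ∧ W.det = 1) ∧
      A = U * diagonal w * Uᵀ ∧ B = W * diagonal w * Wᵀ := by
  have hA' : A.IsHermitian := by simpa [IsHermitian] using hA.eq
  have hB' : B.IsHermitian := by simpa [IsHermitian] using hB.eq
  have hc : A.charpoly = B.charpoly := by
    rw [charpoly_fin_three, charpoly_fin_three, h1, h2, h3]
  have he := (hA'.eigenvalues_eq_eigenvalues_iff hB').mpr hc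
  obtain ⟨U, hU, hU', hAU⟩ := exists_rotation_diagonalizing hA'
  obtain ⟨W, hW, hW', hBW⟩ := exists_rotation_diagonalizing hB'
  exact ⟨_, U, W, ⟨hU, hU'⟩, ⟨hW, hW'⟩, hAU, he ▸ hBW⟩

/-! ### Block coefficients and the action of pairs of rotations -/

/-- Coefficients of the quadratic form `K` on bivectors: the self-dual block, the anti-self-dual block
and the mixed block. -/
abbrev Coeffs : Type := M3 × M3 × M3

/-- The matrix of the Killing tensor with coefficients `c` in the left-invariant frame, at the point
whose rotation is `φ`. -/
def Coeffs.mat (c : Coeffs) (φ : M3) : M3 :=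
  c.1 + φᵀ * c.2.1 * φ + c.2.2 * φ + φᵀ * c.2.2ᵀ

/-- The algebraic consequences of integrability. -/
structure Coeffs.Integrable (c : Coeffs) : Prop where
  symm_fst : c.1.IsSymm
  symm_snd : c.2.1.IsSymm
  trace_one : c.1.trace = c.2.1.trace
  trace_two : (c.1 * c.1).trace = (c.2.1 * c.2.1).trace
  trace_three : (c.1 * c.1 * c.1).trace = (c.2.1 * c.2.1 * c.2.1).trace
  intertwine : c.1 * c.2.2 = c.2.2 * c.2.1

def Coeffs.Commuting (c c' : Coeffs) : Prop :=
  ∀ φ : M3, φᵀ * φ = 1 → φ.det = 1 → Commute (c.mat φ) (c'.mat φ)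

/-- The action of a pair of rotations on coefficients. -/
def Coeffs.conj (U W : M3) (c : Coeffs) : Coeffs :=
  (Uᵀ * c.1 * U, Wᵀ * c.2.1 * W, Uᵀ * c.2.2 * W)

theorem Coeffs.conj_add (U W : M3) (c c' : Coeffs) :
    (c + c').conj U W = c.conj U W + c'.conj U W := by
  simp [Coeffs.conj, mul_add, add_mul]

theorem Coeffs.conj_sub (U W : M3) (c c' : Coeffs) :
    (c - c').conj U W = c.conj U W - c'.conj U W := by
  simp [Coeffs.conj, mul_sub, sub_mul]

theorem trace_conj {U : M3} (hU : Uᵀ * U = 1) (A : M3) : (Uᵀ * A * U).trace = A.trace := by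
  rw [trace_mul_comm, ← mul_assoc, mul_eq_one_comm.mp hU, one_mul]

theorem conj_mul_conj {U : M3} (hU : Uᵀ * U = 1) (W W' A B : M3) :
    (W * A * U) * (Uᵀ * B * W') = W * (A * B) * W' := by
  have h := mul_eq_one_comm.mp hU
  calc (W * A * U) * (Uᵀ * B * W') = W * A * (U * Uᵀ) * B * W' := by simp only [mul_assoc]
    _ = _ := by rw [h]; simp only [mul_assoc, one_mul]

theorem Coeffs.Integrable.conj {c : Coeffs} (hc : c.Integrable) {U W : M3} (hU : Uᵀ * U = 1)
    (hW : Wᵀ * W = 1) : (c.conj U W).Integrable where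
  symm_fst := by
    have := hc.symm_fst
    simp only [IsSymm, Coeffs.conj, transpose_mul, transpose_transpose] at this ⊢
    rw [this, mul_assoc]
  symm_snd := by
    have := hc.symm_snd
    simp only [IsSymm, Coeffs.conj, transpose_mul, transpose_transpose] at this ⊢
    rw [this, mul_assoc]
  trace_one := by simp only [Coeffs.conj, trace_conj hU, trace_conj hW, hc.trace_one]
  trace_two := by
    simp only [Coeffs.conj, conj_mul_conj hU, conj_mul_conj hW, trace_conj hU, trace_conj hW,
      hc.trace_two]
  trace_three := by
    simp only [Coeffs.conj, conj_mul_conj hU, conj_mul_conj hW, trace_conj hU, trace_conj hW,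
      hc.trace_three]
  intertwine := by
    simp only [Coeffs.conj, conj_mul_conj hU, conj_mul_conj hW, hc.intertwine]

/-- A pair of rotations acts on the sphere as an isometry and moves the base point `φ` to `WφUᵀ`.
This allows both diagonal blocks to be diagonalized independently. -/
theorem Coeffs.mat_conj {U W : M3} (hU : Uᵀ * U = 1) (c : Coeffs) (φ : M3) :
    (c.conj U W).mat φ = Uᵀ * c.mat (W * φ * Uᵀ) * U := by
  have e : ∀ X : M3, Uᵀ * (U * X) = X := fun X => by rw [← mul_assoc, hU, one_mul]
  simp only [Coeffs.conj, Coeffs.mat, transpose_mul, transpose_transpose, mul_add, add_mul,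
    mul_assoc, hU, mul_one, e]

theorem Coeffs.Commuting.conj {c c' : Coeffs} (h : c.Commuting c') {U W : M3} (hU : Uᵀ * U = 1)
    (hU' : U.det = 1) (hW : Wᵀ * W = 1) (hW' : W.det = 1) :
    (c.conj U W).Commuting (c'.conj U W) := by
  intro φ hφ hφ'
  have hUU := mul_eq_one_comm.mp hU
  have hc : Commute (c.mat (W * φ * Uᵀ)) (c'.mat (W * φ * Uᵀ)) := by
    refine h _ ?_ (by simp [det_mul, hU', hW', hφ'])
    calc (W * φ * Uᵀ)ᵀ * (W * φ * Uᵀ) = U * (φᵀ * (Wᵀ * W) * φ) * Uᵀ := by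
          simp only [transpose_mul, transpose_transpose, mul_assoc]
      _ = 1 := by rw [hW, mul_one, hφ, mul_one, hUU]
  rw [Coeffs.mat_conj hU, Coeffs.mat_conj hU, Commute, SemiconjBy, conj_mul_conj hU,
    conj_mul_conj hU, hc.eq]

/-! ### Commuting pairs with one diagonal member -/

/-- Here `p`, `m`, `y`, `y'` are the off-diagonal entries at one index pair. The sums `h1 + h2` and
`h3 + h4`, combined with the polarized intertwining relations `hy` and `hy'`, give `p ± m` times a
sum of squares that is positive because `a ≠ b`. -/
theorem offdiag_eq_zero {a b zi zj p m y y' : ℝ} (ha : a - b ≠ 0)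
    (hy : (a - b) * y = zi * m - p * zj) (hy' : (b - a) * y' = zj * m - p * zi)
    (h1 : (a + zi - (b + zj)) * (p + m + y + y') = 0)
    (h2 : (a - zi - (b - zj)) * (p + m - y - y') = 0)
    (h3 : (a + zi - (b - zj)) * (p - m - y + y') = 0)
    (h4 : (a - zi - (b + zj)) * (p - m + y - y') = 0) :
    p = 0 ∧ m = 0 ∧ y = 0 ∧ y' = 0 := by
  have e1 : (p + m) * ((a - b) ^ 2 + (zi - zj) ^ 2) = 0 := by
    linear_combination (a - b) * (h1 + h2) / 2 - (zi - zj) * (hy - hy')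
  have e2 : (p - m) * ((a - b) ^ 2 + (zi + zj) ^ 2) = 0 := by
    linear_combination (a - b) * (h3 + h4) / 2 + (zi + zj) * (hy + hy')
  have p1 : 0 < (a - b) ^ 2 := by positivity
  have f1 : p + m = 0 := (mul_eq_zero.mp e1).resolve_right (by positivity)
  have f2 : p - m = 0 := (mul_eq_zero.mp e2).resolve_right (by positivity)
  have hp : p = 0 := by linarith
  have hm : m = 0 := by linarith
  subst hp hm
  have hb : b - a ≠ 0 := fun h => ha (by linarith)
  refine ⟨rfl, rfl, ?_, ?_⟩
  · simpa [ha] using hy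
  · simpa [hb] using hy'

theorem Coeffs.Commuting.rot {c c' : Coeffs} (h : c.Commuting c') (x y z t : ℝ)
    (hn : x ^ 2 + y ^ 2 + z ^ 2 + t ^ 2 = 1) (i j : Fin 3) :
    (c.mat (rot x y z t) * c'.mat (rot x y z t)) i j =
      (c'.mat (rot x y z t) * c.mat (rot x y z t)) i j := by
  rw [(h _ (rot_transpose_mul hn) (det_rot hn)).eq]

/-- If two commuting Killing tensors are diagonal in the same basis, then so are the self-dual parts
and those are dependent modulo the metric. -/
theorem det_eq_zero_of_commuting {w z w' z' : Fin 3 → ℝ}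
    (hc : Coeffs.Commuting (diagonal w, diagonal w, diagonal z)
      (diagonal w', diagonal w', diagonal z')) :
    (w 0 - w 1) * (w' 0 - w' 2) = (w 0 - w 2) * (w' 0 - w' 1) := by
  -- A cyclic permutation of the axes and one further rotation with rational entries. The desired
  -- minor relation is a linear combination of the commutator entries at these two points.
  have a1 := fun i j => hc.rot (1 / 2) (1 / 2) (1 / 2) (1 / 2) (by norm_num) i j
  have a2 := fun i j => hc.rot (1 / 5) (2 / 5) (2 / 5) (4 / 5) (by norm_num) i j
  have b1 := a1 0 1
  have b2 := a1 0 2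
  have b3 := a1 1 2
  have c1 := a2 0 1
  have c2 := a2 0 2
  have c3 := a2 1 2
  clear a1 a2
  simp [Coeffs.mat, rot, Matrix.mul_apply, Fin.sum_univ_three, diagonal_apply] at b1 b2 b3 c1 c2 c3
  linarith

/-- At the identity and at the half-turns about the axes `φ` is diagonal, so one operand is diagonal
and the commutator decouples into index pairs. The four sign patterns are exactly the input of
`offdiag_eq_zero`. -/
theorem diag_of_commuting {w z : Fin 3 → ℝ} (hw : Function.Injective w) {p m y : M3}
    (hp : p.IsSymm) (hm : m.IsSymm)
    (hi : diagonal w * y + p * diagonal z = diagonal z * m + y * diagonal w)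
    (hc : Coeffs.Commuting (diagonal w, diagonal w, diagonal z) (p, m, y)) :
    p = diagonal p.diag ∧ m = diagonal m.diag ∧ y = diagonal y.diag := by
  have h01 : w 0 - w 1 ≠ 0 := fun e => absurd (hw (sub_eq_zero.mp e)) (by decide)
  have h02 : w 0 - w 2 ≠ 0 := fun e => absurd (hw (sub_eq_zero.mp e)) (by decide)
  have h12 : w 1 - w 2 ≠ 0 := fun e => absurd (hw (sub_eq_zero.mp e)) (by decide)
  have p10 := hp.apply 0 1
  have p20 := hp.apply 0 2
  have p21 := hp.apply 1 2
  have m10 := hm.apply 0 1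
  have m20 := hm.apply 0 2
  have m21 := hm.apply 1 2
  have it := fun i j => congrFun (congrFun hi i) j
  simp only [Matrix.add_apply, diagonal_mul, mul_diagonal] at it
  have o1 := fun i j => hc.rot 1 0 0 0 (by norm_num) i j
  have o2 := fun i j => hc.rot 0 1 0 0 (by norm_num) i j
  have o3 := fun i j => hc.rot 0 0 1 0 (by norm_num) i j
  have o4 := fun i j => hc.rot 0 0 0 1 (by norm_num) i j
  have i01 := it 0 1
  have i02 := it 0 2
  have i12 := it 1 2
  have i10 := it 1 0
  rw [p10, m10] at i10
  have i20 := it 2 0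
  rw [p20, m20] at i20
  have i21 := it 2 1
  rw [p21, m21] at i21
  obtain ⟨hp01, hm01, hy01, hy10⟩ : p 0 1 = 0 ∧ m 0 1 = 0 ∧ y 0 1 = 0 ∧ y 1 0 = 0 := by
    have o1 := o1 0 1
    have o2 := o2 0 1
    have o3 := o3 0 1
    have o4 := o4 0 1
    simp [Coeffs.mat, RoundSphere.rot, Matrix.mul_apply, Fin.sum_univ_three, diagonal_apply]
      at o1 o2 o3 o4
    exact offdiag_eq_zero (zi := z 0) (zj := z 1) h01 (by linarith) (by linarith)
      (by linarith) (by linarith) (by linarith) (by linarith)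
  obtain ⟨hp02, hm02, hy02, hy20⟩ : p 0 2 = 0 ∧ m 0 2 = 0 ∧ y 0 2 = 0 ∧ y 2 0 = 0 := by
    have o1 := o1 0 2
    have o2 := o2 0 2
    have o3 := o3 0 2
    have o4 := o4 0 2
    simp [Coeffs.mat, RoundSphere.rot, Matrix.mul_apply, Fin.sum_univ_three, diagonal_apply]
      at o1 o2 o3 o4
    exact offdiag_eq_zero (zi := z 0) (zj := z 2) h02 (by linarith) (by linarith)
      (by linarith) (by linarith) (by linarith) (by linarith)
  obtain ⟨hp12, hm12, hy12, hy21⟩ : p 1 2 = 0 ∧ m 1 2 = 0 ∧ y 1 2 = 0 ∧ y 2 1 = 0 := by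
    have o1 := o1 1 2
    have o2 := o2 1 2
    have o3 := o3 1 2
    have o4 := o4 1 2
    simp [Coeffs.mat, RoundSphere.rot, Matrix.mul_apply, Fin.sum_univ_three, diagonal_apply]
      at o1 o2 o3 o4
    exact offdiag_eq_zero (zi := z 1) (zj := z 2) h12 (by linarith) (by linarith)
      (by linarith) (by linarith) (by linarith) (by linarith)
  refine ⟨?_, ?_, ?_⟩ <;> ext i j <;> fin_cases i <;> fin_cases j <;> simp [*]

/-- Integrability of the sum and difference polarizes the trace identities. They say that the
difference of the two diagonal vectors is orthogonal to `1`, `w` and `w²`, so it vanishes by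
Vandermonde; `det_eq_zero_of_commuting` then gives the proportionality. -/
theorem eq_smul_of_commuting_diagonal {w z : Fin 3 → ℝ} (hw : Function.Injective w) {p m y : M3}
    (h : Coeffs.Integrable (p, m, y))
    (hD : Coeffs.Integrable (diagonal w, diagonal w, diagonal z))
    (hadd : Coeffs.Integrable ((diagonal w, diagonal w, diagonal z) + (p, m, y)))
    (hsub : Coeffs.Integrable ((diagonal w, diagonal w, diagonal z) - (p, m, y)))
    (hc : Coeffs.Commuting (diagonal w, diagonal w, diagonal z) (p, m, y)) :
    ∃ c d : ℝ, p = c • diagonal w + d • 1 := by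
  have h01 : w 0 - w 1 ≠ 0 := fun e => absurd (hw (sub_eq_zero.mp e)) (by decide)
  have h02 : w 0 - w 2 ≠ 0 := fun e => absurd (hw (sub_eq_zero.mp e)) (by decide)
  have h12 : w 1 - w 2 ≠ 0 := fun e => absurd (hw (sub_eq_zero.mp e)) (by decide)
  have hi : diagonal w * y + p * diagonal z = diagonal z * m + y * diagonal w := by
    have e1 := hadd.intertwine
    have e2 := h.intertwine
    have e3 := hD.intertwine
    simp only [Prod.fst_add, Prod.snd_add, mul_add, add_mul] at e1 e2 e3
    rw [e2, e3] at e1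
    rw [← sub_eq_zero] at e1 ⊢
    rw [← e1]
    abel
  obtain ⟨hp, hm, hy⟩ := diag_of_commuting hw h.symm_fst h.symm_snd hi hc
  generalize p.diag = w' at hp
  generalize m.diag = v' at hm
  generalize y.diag = z' at hy
  subst hp hm hy
  have t1 := h.trace_one
  have t2 := h.trace_two
  have t3 := h.trace_three
  have a2 := hadd.trace_two
  have a3 := hadd.trace_three
  have s3 := hsub.trace_three
  simp only [Prod.fst_add, Prod.snd_add, Prod.fst_sub, Prod.snd_sub, diagonal_add, diagonal_sub,
    diagonal_mul_diagonal, trace_diagonal, Fin.sum_univ_three] at t1 t2 t3 a2 a3 s3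
  have e1 : w 0 * (w' 0 - v' 0) + w 1 * (w' 1 - v' 1) + w 2 * (w' 2 - v' 2) = 0 := by
    linear_combination (a2 - t2) / 2
  -- Subtracting the cubic identities keeps the terms odd in the second tensor; its own cubic
  -- identity removes the pure cubes.
  have e2 : w 0 ^ 2 * (w' 0 - v' 0) + w 1 ^ 2 * (w' 1 - v' 1) + w 2 ^ 2 * (w' 2 - v' 2) = 0 := by
    linear_combination (a3 - s3 - 2 * t3) / 6
  have d0 : w' 0 - v' 0 = 0 := by
    have : (w 0 - w 1) * (w 0 - w 2) * (w' 0 - v' 0) = 0 := by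
      linear_combination e2 - (w 1 + w 2) * e1 + w 1 * w 2 * t1
    simpa [h01, h02] using this
  have d1 : w' 1 - v' 1 = 0 := by
    have : (w 0 - w 1) * (w 1 - w 2) * (w' 1 - v' 1) = 0 := by
      linear_combination - e2 + (w 0 + w 2) * e1 - w 0 * w 2 * t1
    simpa [h01, h12] using this
  obtain rfl : w' = v' := by
    ext i; fin_cases i <;> simp <;> linarith
  have hdet := det_eq_zero_of_commuting hc
  refine ⟨(w' 0 - w' 1) / (w 0 - w 1), w' 0 - (w' 0 - w' 1) / (w 0 - w 1) * w 0, ?_⟩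
  ext i j
  fin_cases i <;> fin_cases j <;> simp <;> field_simp <;> linarith

/-! ### Linear dependence of Weyl parts -/

/-- The trace-free part of a matrix. -/
noncomputable def traceFree : M3 →ₗ[ℝ] M3 :=
  LinearMap.id - ((1 / 3 : ℝ) • (Matrix.traceLinearMap (Fin 3) ℝ ℝ)).smulRight 1

theorem traceFree_apply (A : M3) : traceFree A = A - (A.trace / 3) • (1 : M3) := by
  simp [traceFree, div_eq_inv_mul]

theorem traceFree_one : traceFree 1 = 0 := by
  rw [traceFree_apply, trace_one]; norm_num

/-- Numbers with zero sum and zero product, not all zero, are `λ, 0, -λ` in some order. -/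
theorem injective_of_det_eq_zero {w : Fin 3 → ℝ} {t : ℝ} (h : w 0 + w 1 + w 2 = 3 * t)
    (hd : (w 0 - t) * (w 1 - t) * (w 2 - t) = 0) (hne : ∃ i, w i ≠ t) : Function.Injective w := by
  have key : ∀ a b c : ℝ, a + b + c = 0 → a * b * c = 0 → a = b → a = 0 ∧ b = 0 ∧ c = 0 := by
    rintro a b c h1 h2 rfl
    have hc : c = -2 * a := by linarith
    subst hc
    have : a ^ 3 = 0 := by linarith
    have ha : a = 0 := by simpa using this
    simp [ha]
  have hz : ¬ (w 0 - t = 0 ∧ w 1 - t = 0 ∧ w 2 - t = 0) := by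
    rintro ⟨h0, h1, h2⟩
    obtain ⟨i, hi⟩ := hne
    fin_cases i
    · exact hi (sub_eq_zero.mp h0)
    · exact hi (sub_eq_zero.mp h1)
    · exact hi (sub_eq_zero.mp h2)
  have h01 : w 0 ≠ w 1 := fun e => by
    have := key (w 0 - t) (w 1 - t) (w 2 - t) (by linarith) (by linarith) (by linarith)
    tauto
  have h02 : w 0 ≠ w 2 := fun e => by
    have := key (w 0 - t) (w 2 - t) (w 1 - t) (by linarith) (by linarith) (by linarith)
    tauto
  have h12 : w 1 ≠ w 2 := fun e => by
    have := key (w 1 - t) (w 2 - t) (w 0 - t) (by linarith) (by linarith) (by linarith)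
    tauto
  intro i j hij
  fin_cases i <;> fin_cases j <;>
    first
      | rfl
      | exact absurd hij h01
      | exact absurd hij h02
      | exact absurd hij h12
      | exact absurd hij.symm h01
      | exact absurd hij.symm h02
      | exact absurd hij.symm h12

/-- Vanishing determinant makes the spectrum simple. Both diagonal blocks can be rotated to the same
diagonal matrix, and the intertwining relation then forces the mixed block to be diagonal as well.
-/
theorem eq_smul_of_det_eq_zero {c c' : Coeffs} (h : c.Integrable) (h' : c'.Integrable)
    (hadd : (c + c').Integrable) (hsub : (c - c').Integrable) (hc : c.Commuting c')
    (h0 : traceFree c.1 ≠ 0) (hd : (traceFree c.1).det = 0) :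
    ∃ r s : ℝ, c'.1 = r • c.1 + s • (1 : M3) := by
  obtain ⟨w, U, W, ⟨hU, hU'⟩, ⟨hW, hW'⟩, hp, hm⟩ := exists_rotations_diagonalizing h.symm_fst
    h.symm_snd h.trace_one h.trace_two h.trace_three
  have hUU := mul_eq_one_comm.mp hU
  have e : ∀ X : M3, Uᵀ * (U * X) = X := fun X => by rw [← mul_assoc, hU, one_mul]
  have e' : ∀ X : M3, Wᵀ * (W * X) = X := fun X => by rw [← mul_assoc, hW, one_mul]
  have e2 : ∀ X : M3, U * (Uᵀ * X) = X := fun X => by rw [← mul_assoc, hUU, one_mul]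
  have hT : traceFree c.1 = U * diagonal (fun i => w i - c.1.trace / 3) * Uᵀ := by
    have : diagonal (fun i => w i - c.1.trace / 3) = diagonal w - (c.1.trace / 3) • (1 : M3) := by
      rw [← diagonal_one, ← diagonal_smul, diagonal_sub]; simp
    rw [this, mul_sub, sub_mul, ← hp, traceFree_apply]
    simp [hUU]
  have hw : Function.Injective w := by
    refine injective_of_det_eq_zero (t := c.1.trace / 3) ?_ ?_ ?_
    · have : c.1.trace = (diagonal w).trace := by
        rw [hp, trace_mul_comm, ← mul_assoc, hU, one_mul]
      rw [this]; simp [trace_diagonal, Fin.sum_univ_three]; ring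
    · rw [hT] at hd
      simpa [det_mul, hU', det_diagonal, Fin.prod_univ_three] using hd
    · by_contra! hcon
      apply h0
      rw [hT]
      simp [hcon]
  have c1 : c.conj U W = (diagonal w, diagonal w, Uᵀ * c.2.2 * W) := by
    simp only [Coeffs.conj, Prod.mk.injEq, and_true]
    refine ⟨?_, ?_⟩
    · conv_lhs => rw [hp]
      simp only [mul_assoc, hU, mul_one, e]
    · conv_lhs => rw [hm]
      simp only [mul_assoc, hW, mul_one, e']
  have hi := (h.conj hU hW).intertwine
  rw [c1] at hi
  obtain ⟨z, hz⟩ : ∃ z, Uᵀ * c.2.2 * W = diagonal z := by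
    refine ⟨(Uᵀ * c.2.2 * W).diag, Matrix.ext fun i j => ?_⟩
    · by_cases hij : i = j
      · subst hij; simp
      · have := congrFun (congrFun hi i) j
        simp only [diagonal_mul, mul_diagonal] at this
        rw [diagonal_apply_ne _ hij]
        have hne : w i - w j ≠ 0 := sub_ne_zero.mpr fun e => hij (hw e)
        have h3 : (w i - w j) * (Uᵀ * c.2.2 * W) i j = 0 := by linear_combination this
        exact (mul_eq_zero.mp h3).resolve_left hne
  rw [hz] at c1
  have i1 := h.conj hU hW
  have i2 := hadd.conj hU hW
  have i3 := hsub.conj hU hW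
  have i4 := hc.conj hU hU' hW hW'
  rw [Coeffs.conj_add] at i2
  rw [Coeffs.conj_sub] at i3
  rw [c1] at i1 i2 i3 i4
  obtain ⟨r, s, hrs⟩ := eq_smul_of_commuting_diagonal hw (h'.conj hU hW) i1 i2 i3 i4
  refine ⟨r, s, ?_⟩
  have : U * (Uᵀ * c'.1 * U) * Uᵀ = c'.1 := by
    simp only [mul_assoc, hUU, mul_one, e2]
  rw [← this, hrs]
  conv_rhs => rw [hp]
  simp [mul_add, add_mul, hUU]

theorem Coeffs.mat_add (c c' : Coeffs) (φ : M3) : (c + c').mat φ = c.mat φ + c'.mat φ := by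
  simp only [Coeffs.mat, Prod.fst_add, Prod.snd_add, transpose_add, mul_add, add_mul]
  abel

theorem Coeffs.mat_smul (r : ℝ) (c : Coeffs) (φ : M3) : (r • c).mat φ = r • c.mat φ := by
  simp [Coeffs.mat, Prod.smul_fst, Prod.smul_snd, transpose_smul, smul_add]

/-- Commuting integrable Killing tensors have linearly dependent Weyl parts. -/
theorem exists_traceFree_eq_zero {c c' : Coeffs}
    (hI : ∀ a b : ℝ, (a • c + b • c').Integrable) (hc : c.Commuting c') :
    ∃ a b : ℝ, (a ≠ 0 ∨ b ≠ 0) ∧ traceFree (a • c.1 + b • c'.1) = 0 := by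
  -- The determinant of a `3 × 3` matrix is odd, so along a half-circle of combinations, from `c` to
  -- `-c`, it must vanish somewhere.
  obtain ⟨t, -, ht⟩ : (0 : ℝ) ∈ (fun t : ℝ =>
      (traceFree (Real.cos t • c.1 + Real.sin t • c'.1)).det) '' Set.uIcc 0 Real.pi := by
    apply intermediate_value_uIcc
    · apply Continuous.continuousOn
      have : Continuous traceFree := LinearMap.continuous_of_finiteDimensional _
      fun_prop
    · have : (traceFree (-c.1)).det = - (traceFree c.1).det := by
        rw [map_neg, det_neg]; norm_num
      simp only [Real.cos_zero, Real.sin_zero, Real.cos_pi, Real.sin_pi, one_smul, zero_smul,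
        add_zero, neg_smul, this, Set.mem_uIcc]
      rcases le_total 0 (traceFree c.1).det with h | h
      · right; constructor <;> linarith
      · left; constructor <;> linarith
  set a := Real.cos t
  set b := Real.sin t
  have hab : a ^ 2 + b ^ 2 = 1 := Real.cos_sq_add_sin_sq t
  have hne : a ≠ 0 ∨ b ≠ 0 := by
    by_contra! h
    simp [h.1, h.2] at hab
  by_cases h0 : traceFree (a • c.1 + b • c'.1) = 0
  · exact ⟨a, b, hne, h0⟩
  have comm : (a • c + b • c').Commuting ((-b) • c + a • c') := by
    intro φ h1 h2
    have := hc φ h1 h2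
    simp only [Coeffs.mat_add, Coeffs.mat_smul]
    refine Commute.add_left (Commute.add_right ?_ ?_) (Commute.add_right ?_ ?_)
    · exact ((Commute.refl _).smul_left _).smul_right _
    · exact (this.smul_left _).smul_right _
    · exact (this.symm.smul_left _).smul_right _
    · exact ((Commute.refl _).smul_left _).smul_right _
  obtain ⟨r, s, hrs⟩ := eq_smul_of_det_eq_zero (hI a b) (hI (-b) a)
    (by convert hI (a - b) (b + a) using 1; module)
    (by convert hI (a + b) (b - a) using 1; module) comm h0 ht
  -- The companion combination `(-b, a)` minus `r` times `(a, b)`; it is nonzero because the two are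
  -- orthonormal.
  refine ⟨-b - r * a, a - r * b, ?_, ?_⟩
  · by_contra! h
    have : (1 : ℝ) = 0 := by linear_combination -hab + a * h.2 - b * h.1
    exact one_ne_zero this
  · have : (-b - r * a) • c.1 + (a - r * b) • c'.1 = s • (1 : M3) := by
      have : (-b) • c.1 + a • c'.1 = r • (a • c.1 + b • c'.1) + s • (1 : M3) := hrs
      rw [← sub_eq_zero] at this ⊢
      rw [← this]
      module
    rw [this, map_smul, traceFree_one, smul_zero]

/-! ### Averages over the tetrahedral group -/

/-- The twelve rotations of a regular tetrahedron, as quaternions. -/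
def tetra : Fin 12 → V :=
  ![!₂[1, 0, 0, 0], !₂[0, 1, 0, 0], !₂[0, 0, 1, 0], !₂[0, 0, 0, 1],
    !₂[1 / 2, 1 / 2, 1 / 2, 1 / 2], !₂[1 / 2, 1 / 2, 1 / 2, -1 / 2],
    !₂[1 / 2, 1 / 2, -1 / 2, 1 / 2], !₂[1 / 2, 1 / 2, -1 / 2, -1 / 2],
    !₂[1 / 2, -1 / 2, 1 / 2, 1 / 2], !₂[1 / 2, -1 / 2, 1 / 2, -1 / 2],
    !₂[1 / 2, -1 / 2, -1 / 2, 1 / 2], !₂[1 / 2, -1 / 2, -1 / 2, -1 / 2]]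

def rotAt (x : V) : M3 := rot (x 0) (x 1) (x 2) (x 3)

theorem norm_eq_one_iff (x : V) : ‖x‖ = 1 ↔ x 0 ^ 2 + x 1 ^ 2 + x 2 ^ 2 + x 3 ^ 2 = 1 := by
  rw [EuclideanSpace.norm_eq, Real.sqrt_eq_one]
  simp [Fin.sum_univ_four]

theorem norm_tetra (i : Fin 12) : ‖tetra i‖ = 1 := by
  rw [norm_eq_one_iff]
  fin_cases i <;> simp [tetra] <;> norm_num

theorem rotAt_transpose_mul {x : V} (hx : ‖x‖ = 1) : (rotAt x)ᵀ * rotAt x = 1 :=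
  rot_transpose_mul ((norm_eq_one_iff x).mp hx)

theorem exists_rotAt {A : M3} (h : Aᵀ * A = 1) (hd : A.det = 1) : ∃ x : V, ‖x‖ = 1 ∧ A = rotAt x := by
  obtain ⟨a, b, c, d, hn, rfl⟩ := exists_rot h hd
  exact ⟨!₂[a, b, c, d], by simpa [norm_eq_one_iff] using hn, by simp [rotAt]⟩

theorem sum_rotAt_tetra : ∑ i, rotAt (tetra i) = 0 := by
  ext i j
  rw [Matrix.sum_apply]
  fin_cases i <;> fin_cases j <;> simp [tetra, rotAt, rot, Fin.sum_univ_succ] <;> norm_num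

/-- The tetrahedral group acts irreducibly on three-space, so the sum of conjugates is scalar;
comparing traces, `12 / 3 = 4` is the factor. -/
theorem sum_conj_rotAt_tetra (B : M3) :
    ∑ i, (rotAt (tetra i))ᵀ * B * rotAt (tetra i) = (4 * B.trace) • (1 : M3) := by
  ext i j
  rw [Matrix.sum_apply]
  fin_cases i <;> fin_cases j <;>
    simp [tetra, rotAt, rot, Fin.sum_univ_succ, Matrix.mul_apply, trace_fin_three] <;> ring

theorem sum_trace_conj_rotAt_tetra (A B : M3) :
    ∑ i, (A * ((rotAt (tetra i))ᵀ * B * rotAt (tetra i))).trace = 4 * A.trace * B.trace := by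
  rw [← trace_sum, ← Finset.mul_sum, sum_conj_rotAt_tetra]
  simp; ring

/-! ### From trace identities to polynomial conditions -/

/-- Intertwining trades `p` for `n` across `y`, so in the difference the words with one `y`, with
`y²` or with `yᵀ²` cancel, and so do half of those with one `y` and one `yᵀ`. It is applied with `n
= φᵀmφ` and with `zφ` for `y`. -/
theorem trace_mul_sq_of_intertwine {p n y : M3} (hp : pᵀ = p) (hn : nᵀ = n) (h : p * y = y * n) :
    ((p - n) * ((p + n + y + yᵀ) * (p + n + y + yᵀ))).trace =
      (p * p * p).trace - (n * n * n).trace + (p * p * n).trace - (n * n * p).trace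
        + (p * (yᵀ * y)).trace - (n * (y * yᵀ)).trace := by
  have h' : n * yᵀ = yᵀ * p := by
    have := congrArg transpose h
    simpa [transpose_mul, hp, hn] using this.symm
  have cyc : ∀ a b c : M3, (a * (b * c)).trace = (b * (c * a)).trace := fun a b c => by
    rw [trace_mul_comm, mul_assoc]
  have q1 : (p * (y * y)).trace = (n * (y * y)).trace := by
    rw [← mul_assoc, h, mul_assoc, cyc]
  have q2 : (p * (y * yᵀ)).trace = (n * (yᵀ * y)).trace := by
    rw [← mul_assoc, h, mul_assoc, cyc]
  have q3 : (n * (yᵀ * yᵀ)).trace = (p * (yᵀ * yᵀ)).trace := by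
    rw [← mul_assoc, h', mul_assoc, cyc]
  have a5 : (p * (p * y)).trace = (p * (y * n)).trace := by rw [h]
  have a6 : (n * (p * y)).trace = (n * (y * n)).trace := by rw [h]
  have b5 : (n * (n * yᵀ)).trace = (n * (yᵀ * p)).trace := by rw [h']
  have b6 : (p * (n * yᵀ)).trace = (p * (yᵀ * p)).trace := by rw [h']
  simp only [sub_mul, mul_add, add_mul, mul_assoc, trace_add, trace_sub]
  linarith [cyc n p y, cyc n y p, cyc y p n, cyc p p y, cyc p y p, cyc n n y, cyc n y n,
    cyc n p yᵀ, cyc n yᵀ p, cyc yᵀ p n, cyc p p yᵀ, cyc p yᵀ p, cyc n n yᵀ, cyc n yᵀ n,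
    cyc p p n, cyc p n p, cyc n n p, cyc n p n]

/-- The terms quadratic in `φ` cancel, so the first torsion condition is affine in the entries of
`φ`. -/
theorem Coeffs.trace_mul_mat {p m z φ : M3} (hp : pᵀ = p) (hm : mᵀ = m) (hφ : φᵀ * φ = 1) :
    ((p - φᵀ * m * φ) * Coeffs.mat (p, m, z) φ).trace =
      (p * p).trace - (m * m).trace + 2 * ((p * z - z * m) * φ).trace := by
  have hφ' := mul_eq_one_comm.mp hφ
  have ecancel : ∀ X : M3, φ * (φᵀ * X) = X := fun X => by rw [← mul_assoc, hφ', one_mul]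
  have e1 : (φᵀ * (m * (m * φ))).trace = (m * m).trace := by
    rw [trace_mul_comm, mul_assoc, mul_assoc, hφ', mul_one]
  have e2 : (φᵀ * (m * (φ * (z * φ)))).trace = (z * (m * φ)).trace := by
    have : φᵀ * (m * (φ * (z * φ))) = φᵀ * (m * φ * z * φ) := by simp only [mul_assoc]
    rw [this, trace_mul_comm, mul_assoc, hφ', mul_one, trace_mul_comm, ← mul_assoc]
  have e3 : (p * (φᵀ * zᵀ)).trace = (p * (z * φ)).trace := by
    rw [← trace_transpose, trace_mul_comm]
    simp [transpose_mul, hp]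
  have e4 : (φᵀ * (m * zᵀ)).trace = (z * (m * φ)).trace := by
    rw [← trace_transpose]
    simp [transpose_mul, hm, mul_assoc]
  have e5 : (φᵀ * (m * (φ * p))).trace = (p * (φᵀ * (m * φ))).trace := by
    rw [trace_mul_comm p]
    simp only [mul_assoc]
  simp only [Coeffs.mat, sub_mul, mul_add, mul_assoc, ecancel, trace_add, trace_sub]
  linarith

/-- Killing tensors whose torsion conditions hold along the orbit of rotations have coefficients
subject to polynomial equations. -/
theorem Coeffs.integrable_of_trace_eq_zero {c : Coeffs} (hp : c.1.IsSymm) (hm : c.2.1.IsSymm)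
    (ht : c.1.trace = c.2.1.trace)
    (h1 : ∀ x : V, ‖x‖ = 1 →
      ((c.1 - (rotAt x)ᵀ * c.2.1 * rotAt x) * c.mat (rotAt x)).trace = 0)
    (h2 : ∀ x : V, ‖x‖ = 1 → ((c.1 - (rotAt x)ᵀ * c.2.1 * rotAt x) *
      (c.mat (rotAt x) * c.mat (rotAt x))).trace = 0) : c.Integrable := by
  obtain ⟨p, m, z⟩ := c
  simp only at *
  have key : (p * p).trace = (m * m).trace ∧ p * z = z * m := by
    have e := fun i => h1 (tetra i) (norm_tetra i)
    simp only [Coeffs.trace_mul_mat hp.eq hm.eq (rotAt_transpose_mul (norm_tetra _))] at e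
    have hC : (p * p).trace - (m * m).trace = 0 ∧ p * z - z * m = 0 := by
      -- A constant plus a linear form in `φ` that vanishes at all twelve rotations is zero.
      generalize p * z - z * m = C at e ⊢
      generalize (p * p).trace - (m * m).trace = t at e ⊢
      have f := fun i => e i
      simp [Fin.forall_fin_succ, tetra, rotAt, rot, trace_fin_three, Matrix.mul_apply,
        Fin.sum_univ_three] at f
      obtain ⟨f1, f2, f3, f4, f5, f6, f7, f8, f9, f10, f11, f12⟩ := f
      refine ⟨by linarith, ?_⟩
      ext i j
      fin_cases i <;> fin_cases j <;> simp <;> linarith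
    exact ⟨sub_eq_zero.mp hC.1, sub_eq_zero.mp hC.2⟩
  obtain ⟨hq, hi⟩ := key
  refine ⟨hp, hm, ht, hq, ?_, hi⟩
  have e : ∀ i, (p * p * p).trace - (m * m * m).trace
      + (p * p * ((rotAt (tetra i))ᵀ * m * rotAt (tetra i))).trace
      - (p * ((rotAt (tetra i))ᵀ * (m * m) * rotAt (tetra i))).trace
      + (p * ((rotAt (tetra i))ᵀ * (zᵀ * z) * rotAt (tetra i))).trace
      - ((z * zᵀ) * ((rotAt (tetra i))ᵀ * m * rotAt (tetra i))).trace = 0 := by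
    intro i
    have hφ := rotAt_transpose_mul (norm_tetra i)
    have := h2 (tetra i) (norm_tetra i)
    generalize rotAt (tetra i) = φ at hφ this
    have hφ' := mul_eq_one_comm.mp hφ
    have ecancel : ∀ X : M3, φ * (φᵀ * X) = X := fun X => by rw [← mul_assoc, hφ', one_mul]
    have hn : (φᵀ * m * φ)ᵀ = φᵀ * m * φ := by
      simp only [transpose_mul, transpose_transpose, hm.eq, mul_assoc]
    have hy : p * (z * φ) = z * φ * (φᵀ * m * φ) := by
      rw [← mul_assoc, hi]; simp only [mul_assoc, ecancel]
    have T := trace_mul_sq_of_intertwine hp.eq hn hy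
    have hk : Coeffs.mat (p, m, z) φ = p + φᵀ * m * φ + z * φ + (z * φ)ᵀ := by
      simp [Coeffs.mat, transpose_mul]
    rw [hk, T] at this
    rw [← this]
    have cancel3 : ∀ X : M3, (φᵀ * X).trace = (X * φᵀ).trace := fun X => trace_mul_comm _ _
    have t1 : (φᵀ * (m * (m * (m * φ)))).trace = (m * (m * m)).trace := by
      rw [cancel3]; simp only [mul_assoc, hφ', mul_one]
    have t2 : (p * (φᵀ * (m * (m * φ)))).trace = (φᵀ * (m * (m * (φ * p)))).trace := by
      rw [trace_mul_comm p]; simp only [mul_assoc]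
    have t4 : (z * (zᵀ * (φᵀ * (m * φ)))).trace = (φᵀ * (m * (φ * (z * zᵀ)))).trace := by
      rw [← mul_assoc z, trace_mul_comm (z * zᵀ)]; simp only [mul_assoc]
    simp only [transpose_mul, mul_assoc, ecancel]
    rw [t1, t2, t4]
  -- Summation turns the words containing `φ` into products of traces. These cancel because the
  -- first and second power sums of `p` and `m` already agree, leaving the cubic ones.
  have S := Finset.sum_congr (rfl : (Finset.univ : Finset (Fin 12)) = _) fun i _ => e i
  simp only [Finset.sum_add_distrib, Finset.sum_sub_distrib, sum_trace_conj_rotAt_tetra,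
    Finset.sum_const, Finset.card_univ, Fintype.card_fin] at S
  have hz : (zᵀ * z).trace = (z * zᵀ).trace := trace_mul_comm _ _
  rw [hz, hq, ht] at S
  simp at S
  linarith

/-! ### Calculus on the sphere through radial extension -/

theorem norm_coe_sphere (x : S3) : ‖(x : V)‖ = 1 := norm_eq_of_mem_sphere x

theorem radialExt_smul {F : Type*} [NormedAddCommGroup F] (f : S3 → F) (x : S3) {r : ℝ}
    (hr : 0 < r) :
    radialExt f (r • (x : V)) = f x := by
  have h : ‖r • (x : V)‖⁻¹ • r • (x : V) = x := by
    rw [norm_smul, norm_coe_sphere, mul_one, Real.norm_of_nonneg hr.le, smul_smul,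
      inv_mul_cancel₀ hr.ne', one_smul]
  rw [radialExt, h, Subtype.val_injective.extend_apply]

theorem radialExt_coe {F : Type*} [NormedAddCommGroup F] (f : S3 → F) (x : S3) :
    radialExt f (x : V) = f x := by
  simpa using radialExt_smul f x one_pos

theorem exists_smul_eq {y : V} (hy : y ≠ 0) : ∃ x : S3, y = ‖y‖ • (x : V) :=
  ⟨⟨‖y‖⁻¹ • y, by simp [norm_smul, hy]⟩, by simp [smul_smul, hy]⟩

theorem differentiableAt_radialExt {F : Type*} [NormedAddCommGroup F] [NormedSpace ℝ F]
    {f : S3 → F} (hf : ContMDiff (𝓡 3) 𝓘(ℝ, F) ∞ f) {y : V} (hy : y ≠ 0) : DifferentiableAt ℝ (radialExt f) y := by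
  let U : TopologicalSpace.Opens V := ⟨{0}ᶜ, isOpen_compl_singleton⟩
  let g : U → V := fun y => ‖(y : V)‖⁻¹ • (y : V)
  have hg : ContMDiff 𝓘(ℝ, V) 𝓘(ℝ, V) ∞ g := by
    intro y
    refine (contMDiffAt_subtype_iff (f := fun y : V => ‖y‖⁻¹ • y)).mpr ?_
    have hy : (y : V) ≠ 0 := y.2
    exact (((contDiffAt_norm ℝ hy).inv (norm_ne_zero_iff.mpr hy)).smul contDiffAt_id).contMDiffAt
  have hmem : ∀ y, g y ∈ Metric.sphere (0 : V) 1 := fun y => by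
    have hy : (y : V) ≠ 0 := y.2
    simp [g, norm_smul, hy]
  have : Fact (Module.finrank ℝ V = 3 + 1) := ⟨by simp⟩
  have hcomp := hf.comp (hg.codRestrict_sphere (n := 3) hmem)
  have heq : (fun y : U => radialExt f y) = f ∘ (Set.codRestrict g _ hmem) := by
    ext y
    have : ‖(y : V)‖⁻¹ • (y : V) = ((Set.codRestrict g _ hmem y : S3) : V) := rfl
    rw [radialExt, this, Subtype.val_injective.extend_apply]
    rfl
  have h1 : ContMDiffAt 𝓘(ℝ, V) 𝓘(ℝ, F) ∞ (fun y : U => radialExt f y) ⟨y, hy⟩ := by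
    rw [heq]; exact hcomp _
  have h2 := contMDiffAt_subtype_iff.mp h1
  exact (contMDiffAt_iff_contDiffAt.mp h2).differentiableAt (by simp)

theorem mem_tangent {x : S3} {v : V} : v ∈ tangent x ↔ ⟪(x : V), v⟫_ℝ = 0 :=
  Submodule.mem_orthogonal_singleton_iff_inner_right

theorem P_apply (x : S3) (v : V) : P x v = v - ⟪(x : V), v⟫_ℝ • (x : V) := by
  rw [P, Submodule.starProjection_orthogonal_val,
    Submodule.starProjection_unit_singleton ℝ (norm_coe_sphere x)]

theorem P_apply_of_mem {x : S3} {v : V} (hv : v ∈ tangent x) : P x v = v := by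
  rw [P_apply, mem_tangent.mp hv, zero_smul, sub_zero]

theorem inner_P_left (x : S3) (v w : V) : ⟪P x v, w⟫_ℝ = ⟪v, P x w⟫_ℝ := by
  simp only [P_apply, inner_sub_left, inner_sub_right, real_inner_smul_right,
    real_inner_comm]
  ring

theorem inner_nabla (A : Field) {x : S3} {v w : V} (u : V) (hv : v ∈ tangent x)
    (hw : w ∈ tangent x) : ⟪nabla A x u v, w⟫_ℝ = ⟪D A x u v, w⟫_ℝ := by
  simp [nabla, inner_P_left, P_apply_of_mem hv, P_apply_of_mem hw]

/-- The derivative of a smooth function on the sphere along a great circle. -/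
theorem hasDerivAt_radialExt {F : Type*} [NormedAddCommGroup F] [NormedSpace ℝ F] {f : S3 → F}
    (hf : ContMDiff (𝓡 3) 𝓘(ℝ, F) ∞ f) {c : ℝ → V} {c' : V} {t : ℝ} {x : S3} (hx : c t = x)
    (hc : HasDerivAt c c' t) : HasDerivAt (fun s => radialExt f (c s)) (D f x c') t := by
  have hne : (x : V) ≠ 0 := fun h => by simpa [h] using norm_coe_sphere x
  have := (differentiableAt_radialExt hf hne).hasFDerivAt
  rw [← hx] at this
  rw [D, ← hx]
  exact this.comp_hasDerivAt t hc

/-! ### Killing tensors along great circles -/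

/-- A Killing tensor is a first integral of geodesic motion. The derivative is the Killing equation
on three copies of the velocity, plus terms in the acceleration, which is normal and is killed by
`K`. -/
theorem IsKillingTensor.apply_greatCircle {K : Field} (hK : IsKillingTensor K) {x v : V}
    (hx : ‖x‖ = 1) (hv : ‖v‖ = 1) (hxv : ⟪x, v⟫_ℝ = 0) (t : ℝ) :
    ⟪radialExt K (Real.cos t • x + Real.sin t • v) (-Real.sin t • x + Real.cos t • v),
      -Real.sin t • x + Real.cos t • v⟫_ℝ = ⟪radialExt K x v, v⟫_ℝ := by
  have hxx : ⟪x, x⟫_ℝ = 1 := by rw [real_inner_self_eq_norm_sq, hx]; norm_num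
  have hvv : ⟪v, v⟫_ℝ = 1 := by rw [real_inner_self_eq_norm_sq, hv]; norm_num
  have hvx : ⟪v, x⟫_ℝ = 0 := by rw [real_inner_comm, hxv]
  let c : ℝ → V := fun t => Real.cos t • x + Real.sin t • v
  let c' : ℝ → V := fun t => -Real.sin t • x + Real.cos t • v
  have hc : ∀ t, HasDerivAt c (c' t) t := fun t =>
    ((Real.hasDerivAt_cos t).smul_const x).add ((Real.hasDerivAt_sin t).smul_const v)
  have hc' : ∀ t, HasDerivAt c' (-c t) t := fun t => by
    refine (((Real.hasDerivAt_sin t).neg.smul_const x).add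
      ((Real.hasDerivAt_cos t).smul_const v)).congr_deriv ?_
    simp only [c]; module
  have hn : ∀ t, ‖c t‖ = 1 := fun t => by
    rw [← sq_eq_sq₀ (norm_nonneg _) zero_le_one, ← real_inner_self_eq_norm_sq]
    simp only [c, inner_add_left, inner_add_right, real_inner_smul_left, real_inner_smul_right,
      hxx, hvv, hxv, hvx]
    linear_combination Real.sin_sq_add_cos_sq t
  have horth : ∀ t, ⟪c t, c' t⟫_ℝ = 0 := fun t => by
    simp only [c, c', inner_add_left, inner_add_right, real_inner_smul_left,
      real_inner_smul_right, hxx, hvv, hxv, hvx]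
    ring
  have hderiv : ∀ t, HasDerivAt (fun t => ⟪radialExt K (c t) (c' t), c' t⟫_ℝ) 0 t := by
    intro t
    let y : S3 := ⟨c t, by simpa using hn t⟩
    have hy : c t = y := rfl
    have h1 := ((hasDerivAt_radialExt hK.smooth hy (hc t)).clm_apply (hc' t)).inner ℝ (hc' t)
    have ht : c' t ∈ tangent y := mem_tangent.mpr (horth t)
    have h2 := hK.killing y _ ht _ ht _ ht
    rw [inner_nabla K _ ht ht] at h2
    refine h1.congr_deriv ?_
    rw [hy, radialExt_coe]
    have h3 := hK.normal y
    have h4 := hK.symmetric y (c' t) y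
    simp only [inner_neg_right, map_neg, h3, h4, inner_zero_right, inner_add_left, neg_zero,
      inner_zero_left]
    linarith
  have := is_const_of_deriv_eq_zero (fun t => (hderiv t).differentiableAt)
    (fun t => (hderiv t).deriv) t 0
  simpa [c, c'] using this

/-- A Killing tensor is symmetric in base point and direction. -/
theorem IsKillingTensor.apply_swap_sphere {K : Field} (hK : IsKillingTensor K) (x y : S3) :
    ⟪K x y, y⟫_ℝ = ⟪K y x, x⟫_ℝ := by
  have hxx : ⟪(x : V), x⟫_ℝ = 1 := by
    rw [real_inner_self_eq_norm_sq, norm_coe_sphere]; norm_num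
  have hyy : ⟪(y : V), y⟫_ℝ = 1 := by
    rw [real_inner_self_eq_norm_sq, norm_coe_sphere]; norm_num
  have habs := abs_real_inner_le_norm (x : V) y
  rw [norm_coe_sphere, norm_coe_sphere, mul_one, abs_le] at habs
  set c := ⟪(x : V), y⟫_ℝ with hc
  have hcos : Real.cos (Real.arccos c) = c := Real.cos_arccos habs.1 habs.2
  set t := Real.arccos c
  have hsc := Real.sin_sq_add_cos_sq t
  rw [hcos] at hsc
  have hyx : ⟪(y : V), x⟫_ℝ = c := real_inner_comm _ _
  -- Then `y = ± x`, and both sides vanish because `K` annihilates the normal direction.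
  by_cases hs : Real.sin t = 0
  · have hcc : c ^ 2 = 1 := by simpa [hs] using hsc
    have hz : (y : V) - c • (x : V) = 0 := by
      rw [← inner_self_eq_zero (𝕜 := ℝ)]
      simp only [inner_sub_left, inner_sub_right, real_inner_smul_left, real_inner_smul_right,
        hxx, hyy, ← hc, hyx]
      linear_combination -hcc
    have h1 : (y : V) = c • (x : V) := sub_eq_zero.mp hz
    have h2 : (x : V) = c • (y : V) := by rw [h1, smul_smul, ← pow_two, hcc, one_smul]
    have e1 : K x y = 0 := by rw [h1, map_smul, hK.normal, smul_zero]
    have e2 : K y x = 0 := by rw [h2, map_smul, hK.normal, smul_zero]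
    rw [e1, e2, inner_zero_left, inner_zero_left]
  · set s := Real.sin t
    obtain ⟨z, hz⟩ : ∃ z : V, (y : V) = c • (x : V) + s • z :=
      ⟨s⁻¹ • ((y : V) - c • (x : V)), by rw [smul_smul, mul_inv_cancel₀ hs, one_smul]; abel⟩
    have hsz : s • z = (y : V) - c • (x : V) := by rw [hz]; abel
    have hxz : ⟪(x : V), z⟫_ℝ = 0 := by
      have : s * ⟪(x : V), z⟫_ℝ = 0 := by
        rw [← real_inner_smul_right, hsz, inner_sub_right, real_inner_smul_right, hxx, ← hc]
        ring
      exact (mul_eq_zero.mp this).resolve_left hs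
    have hnz : ‖z‖ = 1 := by
      have : s ^ 2 * ‖z‖ ^ 2 = s ^ 2 := by
        rw [← real_inner_self_eq_norm_sq]
        have : s ^ 2 * ⟪z, z⟫_ℝ = ⟪s • z, s • z⟫_ℝ := by
          rw [real_inner_smul_left, real_inner_smul_right]; ring
        rw [this, hsz]
        simp only [inner_sub_left, inner_sub_right, real_inner_smul_left, real_inner_smul_right,
          hxx, hyy, ← hc, hyx]
        linear_combination -hsc
      have h1 : ‖z‖ ^ 2 = 1 := mul_left_cancel₀ (pow_ne_zero 2 hs) (by rw [this, mul_one])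
      exact (pow_eq_one_iff_of_nonneg (norm_nonneg z) two_ne_zero).mp h1
    have main := hK.apply_greatCircle (norm_coe_sphere x) hnz hxz t
    rw [hcos, ← hz, radialExt_coe, radialExt_coe] at main
    -- The velocity at `y` of the great circle from `x`. Up to normal components `y` is `s z` and
    -- `x` is `-s y'`, so both sides are `s²` times the conserved quantity.
    set y' : V := -s • (x : V) + c • z with hy'
    have hx' : (x : V) = c • (y : V) - s • y' := by
      rw [hy', hz, smul_add, smul_add, smul_smul, smul_smul, smul_smul, smul_smul]
      have : (x : V) = (s ^ 2 + c ^ 2) • (x : V) := by rw [hsc, one_smul]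
      conv_lhs => rw [this]
      module
    have e1 : ⟪K x y, y⟫_ℝ = s ^ 2 * ⟪K x z, z⟫_ℝ := by
      have h0 : ⟪K x z, x⟫_ℝ = 0 := by rw [hK.symmetric, hK.normal, inner_zero_right]
      rw [hz]
      simp only [map_add, map_smul, hK.normal, smul_zero, zero_add, inner_add_right,
        real_inner_smul_left, real_inner_smul_right, h0]
      ring
    have e2 : ⟪K y x, x⟫_ℝ = s ^ 2 * ⟪K y y', y'⟫_ℝ := by
      have h0 : ⟪K y y', y⟫_ℝ = 0 := by rw [hK.symmetric, hK.normal, inner_zero_right]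
      rw [hx']
      simp only [map_sub, map_smul, hK.normal, smul_zero, zero_sub, inner_sub_right,
        inner_neg_left, real_inner_smul_left, real_inner_smul_right, h0]
      ring
    rw [e1, e2, main]

/-! ### Killing tensors as algebraic curvature tensors -/

/-- The homogeneous quadratic extension of a Killing tensor. -/
def quadExt (K : Field) (x : V) : V →L[ℝ] V := ‖x‖ ^ 2 • radialExt K x

theorem quadExt_smul_coe (K : Field) (x : S3) {r : ℝ} (hr : 0 ≤ r) :
    quadExt K (r • (x : V)) = r ^ 2 • K x := by
  rcases hr.eq_or_lt with rfl | hr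
  · ext1 w; simp [quadExt]
  · rw [quadExt, radialExt_smul K x hr, norm_smul, norm_coe_sphere, mul_one,
      Real.norm_of_nonneg hr.le]

theorem exists_smul_coe (y : V) : ∃ (r : ℝ) (x : S3), 0 ≤ r ∧ y = r • (x : V) := by
  by_cases hy : y = 0
  · exact ⟨0, ⟨!₂[1, 0, 0, 0], by simp [norm_eq_one_iff]⟩, le_rfl, by simp [hy]⟩
  · obtain ⟨x, hx⟩ := exists_smul_eq hy
    exact ⟨‖y‖, x, norm_nonneg y, hx⟩

theorem IsKillingTensor.quadExt_swap {K : Field} (hK : IsKillingTensor K) (x y : V) :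
    ⟪quadExt K x y, y⟫_ℝ = ⟪quadExt K y x, x⟫_ℝ := by
  obtain ⟨r, x, hr, rfl⟩ := exists_smul_coe x
  obtain ⟨s, y, hs, rfl⟩ := exists_smul_coe y
  rw [quadExt_smul_coe K x hr, quadExt_smul_coe K y hs]
  simp only [_root_.smul_apply, map_smul, real_inner_smul_left,
    real_inner_smul_right, hK.apply_swap_sphere x y]
  ring

theorem IsSymmetricTensorField.quadExt_symmetric {K : Field} (hK : IsSymmetricTensorField K)
    (x v w : V) : ⟪quadExt K x v, w⟫_ℝ = ⟪quadExt K x w, v⟫_ℝ := by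
  obtain ⟨r, x, hr, rfl⟩ := exists_smul_coe x
  rw [quadExt_smul_coe K x hr]
  rw [_root_.smul_apply, _root_.smul_apply, real_inner_smul_left, real_inner_smul_left,
    hK.symmetric x v w, real_inner_comm]

theorem IsSymmetricTensorField.quadExt_self {K : Field} (hK : IsSymmetricTensorField K)
    (x : V) : quadExt K x x = 0 := by
  obtain ⟨r, x, hr, rfl⟩ := exists_smul_coe x
  rw [quadExt_smul_coe K x hr]
  simp [hK.normal]

theorem quadExt_two_smul (K : Field) (x : V) : quadExt K (x + x) = (4 : ℝ) • quadExt K x := by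
  obtain ⟨r, x, hr, rfl⟩ := exists_smul_coe x
  rw [← two_smul ℝ, smul_smul, quadExt_smul_coe K x hr, quadExt_smul_coe K x (by positivity),
    smul_smul]
  ring_nf

/-- The imaginary part of `x⁻¹ v` (up to scale): the self-dual part of the bivector `x ∧ v`. -/
def leftPart (x v : V) : Fin 3 → ℝ :=
  ![x 0 * v 1 - x 1 * v 0 - (x 2 * v 3 - x 3 * v 2),
    x 0 * v 2 - x 2 * v 0 - (x 3 * v 1 - x 1 * v 3),
    x 0 * v 3 - x 3 * v 0 - (x 1 * v 2 - x 2 * v 1)]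

/-- The imaginary part of `v x⁻¹` (up to scale): the anti-self-dual part of the bivector `x ∧ v`. -/
def rightPart (x v : V) : Fin 3 → ℝ :=
  ![x 0 * v 1 - x 1 * v 0 + (x 2 * v 3 - x 3 * v 2),
    x 0 * v 2 - x 2 * v 0 + (x 3 * v 1 - x 1 * v 3),
    x 0 * v 3 - x 3 * v 0 + (x 1 * v 2 - x 2 * v 1)]

/-- The quadrilinear form with given coefficients, evaluated on the bivectors `x ∧ v` and `y ∧ w`. -/
def Coeffs.form (c : Coeffs) (x v y w : V) : ℝ :=
  leftPart x v ⬝ᵥ c.1 *ᵥ leftPart y w + rightPart x v ⬝ᵥ c.2.1 *ᵥ rightPart y w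
    + leftPart x v ⬝ᵥ c.2.2 *ᵥ rightPart y w + rightPart x v ⬝ᵥ c.2.2ᵀ *ᵥ leftPart y w

/-- `K` is the Killing tensor with coefficients `c`. -/
structure Coeffs.Represents (c : Coeffs) (K : Field) : Prop where
  symm_fst : c.1.IsSymm
  symm_snd : c.2.1.IsSymm
  trace_eq : c.1.trace = c.2.1.trace
  apply : ∀ (x : S3) (v w : V), ⟪K x v, w⟫_ℝ = c.form x v x w

/-- The standard basis. -/
def stdVec (a : Fin 4) : V := EuclideanSpace.single a 1

def idx : Fin 3 → Fin 4 := ![1, 2, 3]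
def idx' : Fin 3 → Fin 4 := ![2, 3, 1]
def idx'' : Fin 3 → Fin 4 := ![3, 1, 2]

def leftCoeff (f : V →ₗ[ℝ] V →ₗ[ℝ] ℝ) (i : Fin 3) : ℝ :=
  (f (stdVec 0) (stdVec (idx i)) - f (stdVec (idx' i)) (stdVec (idx'' i))) / 2

def rightCoeff (f : V →ₗ[ℝ] V →ₗ[ℝ] ℝ) (i : Fin 3) : ℝ :=
  (f (stdVec 0) (stdVec (idx i)) + f (stdVec (idx' i)) (stdVec (idx'' i))) / 2

theorem eq_sum_stdVec (x : V) :
    x = x 0 • stdVec 0 + x 1 • stdVec 1 + x 2 • stdVec 2 + x 3 • stdVec 3 := by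
  ext i
  fin_cases i <;> simp [stdVec]

/-- An alternating form is a linear form on bivectors. -/
theorem alternating_apply (f : V →ₗ[ℝ] V →ₗ[ℝ] ℝ) (hf : ∀ x, f x x = 0) (x v : V) :
    f x v = leftPart x v ⬝ᵥ leftCoeff f + rightPart x v ⬝ᵥ rightCoeff f := by
  have hs : ∀ a b, f a b = -f b a := fun a b => by
    have := hf (a + b)
    simp only [map_add, LinearMap.add_apply, hf] at this
    linarith
  conv_lhs => rw [eq_sum_stdVec x, eq_sum_stdVec v]
  simp only [map_add, map_smul, LinearMap.add_apply, LinearMap.smul_apply, smul_eq_mul, hf]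
  simp only [dotProduct, Fin.sum_univ_three, leftPart, rightPart, leftCoeff, rightCoeff, idx, idx',
    idx'', cons_val_zero, cons_val_one, cons_val]
  rw [hs (stdVec 1) (stdVec 0), hs (stdVec 2) (stdVec 0), hs (stdVec 3) (stdVec 0),
    hs (stdVec 2) (stdVec 1), hs (stdVec 1) (stdVec 3), hs (stdVec 3) (stdVec 2)]
  ring

/-- The polarization of a field of quadratic maps. -/
def polar (Q : V → V →L[ℝ] V) (x y : V) : V →L[ℝ] V := Q (x + y) - Q x - Q y

theorem polar_comm (Q : V → V →L[ℝ] V) (x y : V) : polar Q x y = polar Q y x := by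
  rw [polar, polar, add_comm]; abel

/-- A field of symmetric endomorphisms that is quadratic in the base point, because base point and
direction can be exchanged. -/
structure IsBiquadratic (Q : V → V →L[ℝ] V) : Prop where
  symm : ∀ x v w, ⟪Q x v, w⟫_ℝ = ⟪Q x w, v⟫_ℝ
  swap : ∀ x v, ⟪Q x v, v⟫_ℝ = ⟪Q v x, x⟫_ℝ
  self : ∀ x, Q x x = 0
  two : ∀ x, Q (x + x) = (4 : ℝ) • Q x

namespace IsBiquadratic

variable {Q : V → V →L[ℝ] V}

theorem polar_symm (h : IsBiquadratic Q) (x y v w : V) :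
    ⟪polar Q x y v, w⟫_ℝ = ⟪polar Q x y w, v⟫_ℝ := by
  simp [polar, inner_sub_left, h.symm _ v w]

theorem inner_eq_polar (h : IsBiquadratic Q) (x v w : V) :
    2 * ⟪Q x v, w⟫_ℝ = ⟪polar Q v w x, x⟫_ℝ := by
  have h1 := h.swap x (v + w)
  simp only [map_add, inner_add_left, inner_add_right] at h1
  simp only [polar, _root_.sub_apply, inner_sub_left, ← h1, ← h.swap x v, ← h.swap x w,
    h.symm x w v]
  ring

/-- The exchange moves the base points into argument slots, where linearity holds by construction.
This is what makes the field polynomial in the base point. -/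
theorem polar_swap (h : IsBiquadratic Q) (x y v w : V) :
    ⟪polar Q x y v, w⟫_ℝ = ⟪polar Q v w x, y⟫_ℝ := by
  have h1 := h.inner_eq_polar (x + y) v w
  have h2 := h.inner_eq_polar x v w
  have h3 := h.inner_eq_polar y v w
  simp only [map_add, inner_add_left, inner_add_right, h.polar_symm v w y x] at h1
  rw [polar, _root_.sub_apply, _root_.sub_apply, inner_sub_left, inner_sub_left]
  linarith

theorem polar_add_left (h : IsBiquadratic Q) (x x' y : V) :
    polar Q (x + x') y = polar Q x y + polar Q x' y := by
  ext1 v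
  refine ext_inner_right ℝ fun w => ?_
  rw [_root_.add_apply, inner_add_left, h.polar_swap, h.polar_swap x, h.polar_swap x', map_add,
    inner_add_left]

theorem polar_smul_left (h : IsBiquadratic Q) (r : ℝ) (x y : V) :
    polar Q (r • x) y = r • polar Q x y := by
  ext1 v
  refine ext_inner_right ℝ fun w => ?_
  rw [_root_.smul_apply, real_inner_smul_left, h.polar_swap, h.polar_swap x, map_smul,
    real_inner_smul_left]

theorem polar_add_right (h : IsBiquadratic Q) (x y y' : V) :
    polar Q x (y + y') = polar Q x y + polar Q x y' := by
  rw [polar_comm, h.polar_add_left, polar_comm Q y, polar_comm Q y']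

theorem polar_self (h : IsBiquadratic Q) (x : V) : polar Q x x = (2 : ℝ) • Q x := by
  rw [polar, h.two]; module

theorem polar_cyclic (h : IsBiquadratic Q) (x v : V) :
    polar Q x x v + (2 : ℝ) • polar Q x v x = 0 := by
  have T : ∀ y, polar Q y y y = 0 := fun y => by rw [h.polar_self]; simp [h.self]
  -- The parts of degree `(2, 1)` and `(1, 2)` enter with weights `1, 1` at `x + v` and `2, 4` at `x
  -- + 2v`, so the two equations isolate the first part.
  have h1 := T (x + v)
  have h2 := T (x + v + v)
  simp only [h.polar_add_left, h.polar_add_right, map_add, _root_.add_apply, T,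
    polar_comm Q v x] at h1 h2
  refine ext_inner_right ℝ fun w => ?_
  have e1 := congrArg (⟪·, w⟫_ℝ) h1
  have e2 := congrArg (⟪·, w⟫_ℝ) h2
  simp only [inner_add_left, inner_zero_left] at e1 e2
  rw [inner_add_left, real_inner_smul_left, inner_zero_left]
  linarith

/-- The curvature tensor of a biquadratic field. -/
def curv (Q : V → V →L[ℝ] V) (a b c d : V) : ℝ :=
  (⟪polar Q a c b, d⟫_ℝ - ⟪polar Q a d b, c⟫_ℝ) / 3

theorem curv_pair (h : IsBiquadratic Q) (a b c d : V) : curv Q a b c d = curv Q c d a b := by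
  rw [curv, curv, polar_comm Q a c, h.polar_symm c a b d, h.polar_swap a d, polar_comm Q b c,
    h.polar_symm c b a d]

theorem curv_self (h : IsBiquadratic Q) (a c d : V) : curv Q a a c d = 0 := by
  rw [curv, h.polar_swap a d, sub_self, zero_div]

theorem curv_bianchi (h : IsBiquadratic Q) (a b c d : V) :
    curv Q a b c d + curv Q a c d b + curv Q a d b c = 0 := by
  simp only [curv, h.polar_symm a c d b, h.polar_symm a b c d, h.polar_symm a d c b]
  ring

/-- By `polar_cyclic` the second term of `curv` contributes half as much as the first, which is `2
Q`; this is the reason for the factor `1 / 3`. -/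
theorem inner_eq_curv (h : IsBiquadratic Q) (x v w : V) : ⟪Q x v, w⟫_ℝ = curv Q x v x w := by
  have h1 := congrArg (⟪·, w⟫_ℝ) (h.polar_cyclic x v)
  simp only [inner_add_left, real_inner_smul_left, inner_zero_left] at h1
  have h2 : ⟪polar Q x w v, x⟫_ℝ = ⟪polar Q x v x, w⟫_ℝ := by
    rw [h.polar_swap, polar_comm]
  have h3 := congrArg (fun A : V →L[ℝ] V => ⟪A v, w⟫_ℝ) (h.polar_self x)
  simp only [_root_.smul_apply, real_inner_smul_left] at h3
  rw [curv, h2]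
  linarith

/-- The curvature tensor as a bilinear form of its first two arguments. -/
def curvForm (h : IsBiquadratic Q) (c d : V) : V →ₗ[ℝ] V →ₗ[ℝ] ℝ :=
  LinearMap.mk₂ ℝ (fun a b => curv Q a b c d)
    (fun a a' b => by simp only [curv, h.polar_add_left, _root_.add_apply, inner_add_left]; ring)
    (fun r a b => by
      simp only [curv, h.polar_smul_left, _root_.smul_apply, real_inner_smul_left, smul_eq_mul]
      ring)
    (fun a b b' => by simp only [curv, map_add, inner_add_left]; ring)
    (fun r a b => by simp only [curv, map_smul, real_inner_smul_left, smul_eq_mul]; ring)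

theorem curvForm_apply (h : IsBiquadratic Q) (a b c d : V) :
    h.curvForm c d a b = curv Q a b c d := rfl

def leftForm (h : IsBiquadratic Q) (i : Fin 3) : V →ₗ[ℝ] V →ₗ[ℝ] ℝ :=
  (1 / 2 : ℝ) • (h.curvForm (stdVec 0) (stdVec (idx i))
    - h.curvForm (stdVec (idx' i)) (stdVec (idx'' i)))

def rightForm (h : IsBiquadratic Q) (i : Fin 3) : V →ₗ[ℝ] V →ₗ[ℝ] ℝ :=
  (1 / 2 : ℝ) • (h.curvForm (stdVec 0) (stdVec (idx i))
    + h.curvForm (stdVec (idx' i)) (stdVec (idx'' i)))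

def coeffs (h : IsBiquadratic Q) : Coeffs :=
  (of fun i => leftCoeff (h.leftForm i), of fun i => rightCoeff (h.rightForm i),
    of fun i => rightCoeff (h.leftForm i))

theorem leftForm_apply (h : IsBiquadratic Q) (i : Fin 3) (x w : V) :
    h.leftForm i x w = leftCoeff (h.curvForm x w) i := by
  simp only [leftForm, leftCoeff, LinearMap.smul_apply, LinearMap.sub_apply, curvForm_apply,
    smul_eq_mul, h.curv_pair x w]
  ring

theorem rightForm_apply (h : IsBiquadratic Q) (i : Fin 3) (x w : V) :
    h.rightForm i x w = rightCoeff (h.curvForm x w) i := by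
  simp only [rightForm, rightCoeff, LinearMap.smul_apply, LinearMap.add_apply, curvForm_apply,
    smul_eq_mul, h.curv_pair x w]
  ring

theorem transpose_mixed (h : IsBiquadratic Q) (i : Fin 3) (j : Fin 3) :
    rightCoeff (h.leftForm j) i = leftCoeff (h.rightForm i) j := by
  simp only [rightCoeff, leftForm_apply, leftCoeff, rightForm_apply, curvForm_apply]
  linarith [h.curv_pair (stdVec 0) (stdVec (idx i)) (stdVec 0) (stdVec (idx j)),
    h.curv_pair (stdVec 0) (stdVec (idx i)) (stdVec (idx' j)) (stdVec (idx'' j)),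
    h.curv_pair (stdVec (idx' i)) (stdVec (idx'' i)) (stdVec 0) (stdVec (idx j)),
    h.curv_pair (stdVec (idx' i)) (stdVec (idx'' i)) (stdVec (idx' j)) (stdVec (idx'' j))]

theorem symm_left (h : IsBiquadratic Q) (i j : Fin 3) :
    leftCoeff (h.leftForm j) i = leftCoeff (h.leftForm i) j := by
  simp only [leftForm_apply, leftCoeff, curvForm_apply]
  linarith [h.curv_pair (stdVec 0) (stdVec (idx i)) (stdVec 0) (stdVec (idx j)),
    h.curv_pair (stdVec 0) (stdVec (idx i)) (stdVec (idx' j)) (stdVec (idx'' j)),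
    h.curv_pair (stdVec (idx' i)) (stdVec (idx'' i)) (stdVec 0) (stdVec (idx j)),
    h.curv_pair (stdVec (idx' i)) (stdVec (idx'' i)) (stdVec (idx' j)) (stdVec (idx'' j))]

theorem symm_right (h : IsBiquadratic Q) (i j : Fin 3) :
    rightCoeff (h.rightForm j) i = rightCoeff (h.rightForm i) j := by
  simp only [rightForm_apply, rightCoeff, curvForm_apply]
  linarith [h.curv_pair (stdVec 0) (stdVec (idx i)) (stdVec 0) (stdVec (idx j)),
    h.curv_pair (stdVec 0) (stdVec (idx i)) (stdVec (idx' j)) (stdVec (idx'' j)),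
    h.curv_pair (stdVec (idx' i)) (stdVec (idx'' i)) (stdVec 0) (stdVec (idx j)),
    h.curv_pair (stdVec (idx' i)) (stdVec (idx'' i)) (stdVec (idx' j)) (stdVec (idx'' j))]

/-- The difference of the two traces is, up to sign, the Bianchi sum on the four basis vectors. -/
theorem trace_eq (h : IsBiquadratic Q) : h.coeffs.1.trace = h.coeffs.2.1.trace := by
  simp only [coeffs, trace_fin_three, of_apply, leftForm_apply, leftCoeff, rightForm_apply,
    rightCoeff, curvForm_apply, idx, idx', idx'', cons_val_zero, cons_val_one, cons_val]
  linarith [h.curv_bianchi (stdVec 0) (stdVec 1) (stdVec 2) (stdVec 3),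
    h.curv_pair (stdVec 0) (stdVec 1) (stdVec 2) (stdVec 3),
    h.curv_pair (stdVec 0) (stdVec 2) (stdVec 3) (stdVec 1),
    h.curv_pair (stdVec 0) (stdVec 3) (stdVec 1) (stdVec 2)]

theorem inner_eq_form (h : IsBiquadratic Q) (x v w : V) :
    ⟪Q x v, w⟫_ℝ = h.coeffs.form x v x w := by
  have hl : ∀ i, leftCoeff (h.curvForm x w) i
      = leftPart x w ⬝ᵥ leftCoeff (h.leftForm i) + rightPart x w ⬝ᵥ rightCoeff (h.leftForm i) :=
    fun i => by
      rw [← leftForm_apply, alternating_apply _ fun y => ?_]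
      rw [leftForm_apply, leftCoeff]; simp [curvForm_apply, h.curv_pair _ _ y y, h.curv_self]
  have hr : ∀ i, rightCoeff (h.curvForm x w) i
      = leftPart x w ⬝ᵥ leftCoeff (h.rightForm i) + rightPart x w ⬝ᵥ rightCoeff (h.rightForm i) :=
    fun i => by
      rw [← rightForm_apply, alternating_apply _ fun y => ?_]
      rw [rightForm_apply, rightCoeff]; simp [curvForm_apply, h.curv_pair _ _ y y, h.curv_self]
  rw [h.inner_eq_curv, ← h.curvForm_apply, alternating_apply _ fun y => by
    rw [curvForm_apply, h.curv_self]]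
  simp only [dotProduct, hl, hr, Coeffs.form, coeffs, mulVec, Fin.sum_univ_three, of_apply,
    transpose_apply, h.transpose_mixed]
  ring

end IsBiquadratic

theorem IsKillingTensor.isBiquadratic {K : Field} (hK : IsKillingTensor K) :
    IsBiquadratic (quadExt K) where
  symm := hK.quadExt_symmetric
  swap := hK.quadExt_swap
  self := hK.quadExt_self
  two := quadExt_two_smul K

/-- Every Killing tensor on the sphere is given by an algebraic curvature tensor. -/
theorem IsKillingTensor.exists_represents {K : Field} (hK : IsKillingTensor K) :
    ∃ c : Coeffs, c.Represents K := by
  have h := hK.isBiquadratic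
  refine ⟨h.coeffs, IsSymm.ext fun i j => h.symm_left i j, IsSymm.ext fun i j => h.symm_right i j,
    h.trace_eq, fun x v w => ?_⟩
  rw [← h.inner_eq_form, ← one_smul ℝ (x : V), quadExt_smul_coe K x zero_le_one]
  simp

/-! ### The left-invariant frame -/

theorem inner_eq_sum (u v : V) : ⟪u, v⟫_ℝ = u 0 * v 0 + u 1 * v 1 + u 2 * v 2 + u 3 * v 3 := by
  simp only [PiLp.inner_apply, Fin.sum_univ_four, RCLike.inner_apply, conj_trivial]
  ring

/-- The quaternion product `x a` with an imaginary quaternion `a`: a vector tangent to the sphere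
at `x`. -/
def leftTranslate (x : V) (a : Fin 3 → ℝ) : V :=
  !₂[-x 1 * a 0 - x 2 * a 1 - x 3 * a 2, x 0 * a 0 - x 3 * a 1 + x 2 * a 2,
    x 3 * a 0 + x 0 * a 1 - x 1 * a 2, -x 2 * a 0 + x 1 * a 1 + x 0 * a 2]

theorem leftTranslate_mem_tangent (x : S3) (a : Fin 3 → ℝ) : leftTranslate x a ∈ tangent x := by
  rw [mem_tangent, inner_eq_sum]
  simp [leftTranslate]; ring

theorem leftPart_leftTranslate {x : V} (hx : ‖x‖ = 1) (a : Fin 3 → ℝ) :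
    leftPart x (leftTranslate x a) = a := by
  rw [norm_eq_one_iff] at hx
  ext i
  fin_cases i <;> simp [leftPart, leftTranslate]
  · linear_combination a 0 * hx
  · linear_combination a 1 * hx
  · linear_combination a 2 * hx

/-- Since `x a = (x a x⁻¹) x`, passing from the left to the right trivialization is the rotation of
`x`. -/
theorem rightPart_leftTranslate (x : V) (a : Fin 3 → ℝ) :
    rightPart x (leftTranslate x a) = rotAt x *ᵥ a := by
  ext i
  fin_cases i <;> simp [rightPart, leftTranslate, rotAt, rot, mulVec, dotProduct,
    Fin.sum_univ_three] <;> ring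

/-- The sign here, opposite to that in `rightPart_leftTranslate_leftTranslate`, distinguishes
`Coeffs.dmat` from `Coeffs.mat`. -/
theorem leftPart_leftTranslate_leftTranslate {x : V} (hx : ‖x‖ = 1) (a b : Fin 3 → ℝ) :
    leftPart (leftTranslate x a) (leftTranslate x b) = -(a ⨯₃ b) := by
  rw [norm_eq_one_iff] at hx
  ext i
  fin_cases i <;> simp [leftPart, leftTranslate, cross_apply]
  · linear_combination -(a 1 * b 2 - a 2 * b 1) * hx
  · linear_combination -(a 2 * b 0 - a 0 * b 2) * hx
  · linear_combination -(a 0 * b 1 - a 1 * b 0) * hx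

theorem rightPart_leftTranslate_leftTranslate (x : V) (a b : Fin 3 → ℝ) :
    rightPart (leftTranslate x a) (leftTranslate x b) = rotAt x *ᵥ (a ⨯₃ b) := by
  ext i
  fin_cases i <;> simp [rightPart, leftTranslate, rotAt, rot, mulVec, dotProduct, cross_apply,
    Fin.sum_univ_three] <;> ring

theorem exists_leftTranslate {x : S3} {v : V} (hv : v ∈ tangent x) :
    v = leftTranslate x (leftPart x v) := by
  have hx := (norm_eq_one_iff _).mp (norm_coe_sphere x)
  rw [mem_tangent, inner_eq_sum] at hv
  ext i
  fin_cases i <;> simp [leftPart, leftTranslate]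
  · linear_combination -(v 0) * hx + (x : V) 0 * hv
  · linear_combination -(v 1) * hx + (x : V) 1 * hv
  · linear_combination -(v 2) * hx + (x : V) 2 * hv
  · linear_combination -(v 3) * hx + (x : V) 3 * hv

theorem inner_leftTranslate {x : V} (hx : ‖x‖ = 1) (a b : Fin 3 → ℝ) :
    ⟪leftTranslate x a, leftTranslate x b⟫_ℝ = a ⬝ᵥ b := by
  rw [norm_eq_one_iff] at hx
  rw [inner_eq_sum]
  simp [leftTranslate, dotProduct, Fin.sum_univ_three]
  linear_combination (a 0 * b 0 + a 1 * b 1 + a 2 * b 2) * hx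

theorem leftPart_add_left (x y v : V) : leftPart (x + y) v = leftPart x v + leftPart y v := by
  ext i; fin_cases i <;> simp [leftPart] <;> ring

theorem leftPart_smul_left (r : ℝ) (x v : V) : leftPart (r • x) v = r • leftPart x v := by
  ext i; fin_cases i <;> simp [leftPart] <;> ring

theorem rightPart_add_left (x y v : V) : rightPart (x + y) v = rightPart x v + rightPart y v := by
  ext i; fin_cases i <;> simp [rightPart] <;> ring

theorem rightPart_smul_left (r : ℝ) (x v : V) : rightPart (r • x) v = r • rightPart x v := by
  ext i; fin_cases i <;> simp [rightPart] <;> ring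

theorem Coeffs.form_smul (c : Coeffs) (r s : ℝ) (x v y w : V) :
    c.form (r • x) v (s • y) w = r * s * c.form x v y w := by
  simp only [Coeffs.form, leftPart_smul_left, rightPart_smul_left, mulVec_smul, smul_dotProduct,
    dotProduct_smul, smul_eq_mul]
  ring

theorem Coeffs.form_add (c : Coeffs) (x x' v y y' w : V) :
    c.form (x + x') v (y + y') w =
      c.form x v y w + c.form x v y' w + (c.form x' v y w + c.form x' v y' w) := by
  simp only [Coeffs.form, leftPart_add_left, rightPart_add_left, mulVec_add, add_dotProduct,
    dotProduct_add]
  ring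

theorem Coeffs.Represents.inner_quadExt {c : Coeffs} {K : Field} (h : c.Represents K) (y v w : V) :
    ⟪quadExt K y v, w⟫_ℝ = c.form y v y w := by
  obtain ⟨r, x, hr, rfl⟩ := exists_smul_coe y
  rw [quadExt_smul_coe K x hr, c.form_smul, _root_.smul_apply, real_inner_smul_left, h.apply]
  ring

theorem Coeffs.Represents.inner_D {c : Coeffs} {K : Field} (h : c.Represents K)
    (hK : IsSymmetricTensorField K) {x : S3} {u : V} (hu : u ∈ tangent x) (v w : V) :
    ⟪D K x u v, w⟫_ℝ = c.form x v u w + c.form u v x w := by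
  have hc : HasDerivAt (fun t : ℝ => (x : V) + t • u) u 0 := by
    simpa using ((hasDerivAt_id (0 : ℝ)).smul_const u).const_add (x : V)
  have h1 := hasDerivAt_radialExt hK.smooth (x := x) (t := 0) (by simp) hc
  have h2 : HasDerivAt (fun t : ℝ => ⟪radialExt K ((x : V) + t • u) v, w⟫_ℝ) ⟪D K x u v, w⟫_ℝ 0 := by
    refine ((h1.clm_apply (hasDerivAt_const 0 v)).inner ℝ (hasDerivAt_const 0 w)).congr_deriv ?_
    simp
  have h3 : HasDerivAt (fun t : ℝ => ‖(x : V) + t • u‖ ^ 2) 0 0 := by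
    refine (hc.norm_sq).congr_deriv ?_
    simp [mem_tangent.mp hu]
  have h4 := h3.mul h2
  -- After multiplication by the squared norm the function is a polynomial in `t`. That factor is
  -- stationary at `0` because `u` is tangent, so the derivative is unaffected.
  have e : (fun t : ℝ => ‖(x : V) + t • u‖ ^ 2) * (fun t : ℝ => ⟪radialExt K ((x : V) + t • u) v, w⟫_ℝ)
      = fun t : ℝ => c.form x v x w + t * (c.form x v u w + c.form u v x w)
        + t ^ 2 * c.form u v u w := by
    ext t
    have := h.inner_quadExt ((x : V) + t • u) v w
    rw [quadExt, _root_.smul_apply, real_inner_smul_left] at this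
    rw [Pi.mul_apply, this, c.form_add]
    have e1 := c.form_smul 1 t x v u w
    have e2 := c.form_smul t 1 u v x w
    have e3 := c.form_smul t t u v u w
    simp only [one_smul] at e1 e2
    rw [e1, e2, e3]
    ring
  rw [e] at h4
  have h5 : HasDerivAt (fun t : ℝ => c.form x v x w + t * (c.form x v u w + c.form u v x w)
        + t ^ 2 * c.form u v u w) (c.form x v u w + c.form u v x w) 0 := by
    refine ((((hasDerivAt_id (0 : ℝ)).mul_const _).const_add _).add
      (((hasDerivAt_id (0 : ℝ)).pow 2).mul_const _)).congr_deriv ?_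
    simp
  have := h4.unique h5
  simpa [norm_coe_sphere] using this

/-! ### Covariant derivative and torsion in the frame -/

/-- The antisymmetric counterpart of `Coeffs.mat`, which governs the covariant derivative. -/
def Coeffs.dmat (c : Coeffs) (φ : M3) : M3 :=
  c.1 - φᵀ * c.2.1 * φ - c.2.2 * φ + φᵀ * c.2.2ᵀ

theorem mulVec_dotProduct (A : M3) (a b : Fin 3 → ℝ) : (A *ᵥ a) ⬝ᵥ b = a ⬝ᵥ Aᵀ *ᵥ b := by
  rw [dotProduct_comm, dotProduct_mulVec, ← mulVec_transpose, dotProduct_comm]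

theorem Coeffs.Represents.inner_apply {c : Coeffs} {K : Field} (h : c.Represents K) (x : S3)
    (a b : Fin 3 → ℝ) : ⟪K x (leftTranslate x a), leftTranslate x b⟫_ℝ
      = a ⬝ᵥ c.mat (rotAt x) *ᵥ b := by
  rw [h.apply, Coeffs.form, leftPart_leftTranslate (norm_coe_sphere x),
    leftPart_leftTranslate (norm_coe_sphere x), rightPart_leftTranslate, rightPart_leftTranslate]
  simp only [mulVec_dotProduct, mulVec_mulVec, Coeffs.mat, add_mulVec, dotProduct_add, mul_assoc]

theorem Coeffs.Represents.apply_leftTranslate {c : Coeffs} {K : Field} (h : c.Represents K)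
    (hK : IsSymmetricTensorField K) (x : S3) (a : Fin 3 → ℝ) :
    K x (leftTranslate x a) = leftTranslate x ((c.mat (rotAt x))ᵀ *ᵥ a) := by
  have ht : K x (leftTranslate x a) ∈ tangent x := by
    rw [mem_tangent, real_inner_comm, hK.symmetric, hK.normal, inner_zero_right]
  rw [exists_leftTranslate ht]
  congr 1
  refine dotProduct_eq _ _ fun b => ?_
  rw [← inner_leftTranslate (norm_coe_sphere x), ← exists_leftTranslate ht, h.inner_apply,
    mulVec_dotProduct, transpose_transpose]

theorem Coeffs.Represents.inner_nabla {c : Coeffs} {K : Field} (h : c.Represents K)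
    (hK : IsSymmetricTensorField K) (x : S3) (a b d : Fin 3 → ℝ) :
    ⟪nabla K x (leftTranslate x a) (leftTranslate x b), leftTranslate x d⟫_ℝ
      = -(b ⬝ᵥ c.dmat (rotAt x) *ᵥ (a ⨯₃ d) + d ⬝ᵥ c.dmat (rotAt x) *ᵥ (a ⨯₃ b)) := by
  rw [RoundSphere.inner_nabla _ _ (leftTranslate_mem_tangent x b) (leftTranslate_mem_tangent x d),
    h.inner_D hK (leftTranslate_mem_tangent x a), Coeffs.form, Coeffs.form]
  simp only [leftPart_leftTranslate (norm_coe_sphere x), rightPart_leftTranslate,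
    leftPart_leftTranslate_leftTranslate (norm_coe_sphere x), rightPart_leftTranslate_leftTranslate]
  have hp := h.symm_fst.eq
  have hm := h.symm_snd.eq
  generalize rotAt x = φ
  generalize a ⨯₃ d = e
  generalize a ⨯₃ b = f
  have key : ∀ A : M3, f ⬝ᵥ A *ᵥ d = d ⬝ᵥ Aᵀ *ᵥ f := fun A => by
    rw [dotProduct_comm, mulVec_dotProduct]
  simp only [mulVec_dotProduct, mulVec_mulVec, Coeffs.dmat, add_mulVec, sub_mulVec, dotProduct_add,
    dotProduct_sub, mul_assoc, mulVec_neg, dotProduct_neg, neg_dotProduct, key, transpose_mul,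
    transpose_transpose, hp, hm]
  ring

/-- The trilinear form `∇K` in a frame, expressed by a matrix. -/
def nablaForm (X : M3) (a b d : Fin 3 → ℝ) : ℝ :=
  -(b ⬝ᵥ X *ᵥ (a ⨯₃ d) + d ⬝ᵥ X *ᵥ (a ⨯₃ b))

/-- The Nijenhuis torsion in a frame. -/
def torsionForm (k X : M3) (a b d : Fin 3 → ℝ) : ℝ :=
  (nablaForm X b a (k *ᵥ d) - nablaForm X a b (k *ᵥ d)
    + (nablaForm X (k *ᵥ a) b d - nablaForm X (k *ᵥ b) a d)) / 2

/-- In dimension three a completely antisymmetric form is determined by its value on one basis, so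
each torsion condition is a single scalar equation. -/
theorem torsionForm_cyclic {k : M3} (hk : k.IsSymm) (X : M3) :
    torsionForm k X ![1, 0, 0] ![0, 1, 0] ![0, 0, 1]
      + torsionForm k X ![0, 1, 0] ![0, 0, 1] ![1, 0, 0]
      + torsionForm k X ![0, 0, 1] ![1, 0, 0] ![0, 1, 0]
      = (3 * (X * k).trace - k.trace * X.trace) / 2 := by
  have k10 := hk.apply 0 1
  have k20 := hk.apply 0 2
  have k21 := hk.apply 1 2
  simp [torsionForm, nablaForm, mulVec, dotProduct, cross_apply, Fin.sum_univ_three,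
    trace_fin_three, Matrix.mul_apply, k10, k20, k21]
  ring

theorem torsionForm_cyclic_mulVec {k : M3} (hk : k.IsSymm) (X : M3) :
    torsionForm k X ![1, 0, 0] ![0, 1, 0] (k *ᵥ ![0, 0, 1])
      + torsionForm k X ![0, 1, 0] ![0, 0, 1] (k *ᵥ ![1, 0, 0])
      + torsionForm k X ![0, 0, 1] ![1, 0, 0] (k *ᵥ ![0, 1, 0])
      = (6 * (X * (k * k)).trace - 3 * k.trace * (X * k).trace
        + (k.trace ^ 2 - 2 * (k * k).trace) * X.trace) / 2 := by
  have k10 := hk.apply 0 1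
  have k20 := hk.apply 0 2
  have k21 := hk.apply 1 2
  simp [torsionForm, nablaForm, mulVec, dotProduct, cross_apply, Fin.sum_univ_three,
    trace_fin_three, Matrix.mul_apply, k10, k20, k21]
  ring

theorem Coeffs.mat_isSymm {c : Coeffs} (hp : c.1.IsSymm) (hm : c.2.1.IsSymm) (φ : M3) :
    (c.mat φ).IsSymm := by
  simp only [IsSymm, Coeffs.mat, transpose_add, transpose_mul, transpose_transpose, hp.eq, hm.eq,
    mul_assoc]
  abel

theorem Coeffs.Represents.inner_nijenhuis {c : Coeffs} {K : Field} (h : c.Represents K)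
    (hK : IsSymmetricTensorField K) (x : S3) (a b d : Fin 3 → ℝ) :
    ⟪nijenhuis K x (leftTranslate x a) (leftTranslate x b), leftTranslate x d⟫_ℝ
      = torsionForm (c.mat (rotAt x)) (c.dmat (rotAt x)) a b d := by
  have hs := (Coeffs.mat_isSymm h.symm_fst h.symm_snd (rotAt x)).eq
  have e1 : ∀ u v w, ⟪K x (nabla K x u v), leftTranslate x w⟫_ℝ
      = ⟪nabla K x u v, leftTranslate x (c.mat (rotAt x) *ᵥ w)⟫_ℝ := fun u v w => by
    rw [hK.symmetric, h.apply_leftTranslate hK, hs]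
  simp only [nijenhuis, real_inner_smul_left, inner_add_left, inner_sub_left, map_sub, e1,
    h.apply_leftTranslate hK, hs, h.inner_nabla hK, torsionForm, nablaForm]
  ring

theorem trace_mul_eq_zero_of_symm {A B : M3} (hA : Aᵀ = -A) (hB : Bᵀ = B) :
    (A * B).trace = 0 := by
  have : (A * B).trace = -(A * B).trace := by
    conv_lhs => rw [← trace_transpose, transpose_mul, hA, hB, trace_mul_comm, neg_mul, trace_neg]
  linarith

/-- The coefficients of an integrable Killing tensor satisfy the algebraic integrability conditions. -/
theorem Coeffs.Represents.integrable {c : Coeffs} {K : Field} (h : c.Represents K)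
    (hK : IsSymmetricTensorField K) (hI : IsIntegrable K) : c.Integrable := by
  -- Splits off a skew part, which has zero trace against the symmetric matrices `k` and `k²`; only
  -- the symmetric part enters the torsion conditions.
  have anti : ∀ φ : M3, c.dmat φ = (c.1 - φᵀ * c.2.1 * φ) + ((c.2.2 * φ)ᵀ - c.2.2 * φ) := fun φ => by
    simp only [Coeffs.dmat, transpose_mul]; abel
  have anti' : ∀ A : M3, (Aᵀ - A)ᵀ = -(Aᵀ - A) := fun A => by simp
  have tr0 : ∀ x : V, ‖x‖ = 1 → (c.dmat (rotAt x)).trace = 0 := fun x hx => by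
    rw [anti]
    simp [trace_conj (rotAt_transpose_mul hx), h.trace_eq, -transpose_mul]
  have one : ∀ x : V, ‖x‖ = 1 → (c.dmat (rotAt x) * c.mat (rotAt x)).trace = 0 := fun x hx => by
    have hs := Coeffs.mat_isSymm h.symm_fst h.symm_snd (rotAt x)
    let y : S3 := ⟨x, by simpa using hx⟩
    have ht := leftTranslate_mem_tangent y
    have := hI.first y _ (ht ![1, 0, 0]) _ (ht ![0, 1, 0]) _ (ht ![0, 0, 1])
    simp only [h.inner_nijenhuis hK y] at this
    rw [torsionForm_cyclic hs, tr0 y hx] at this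
    change (c.dmat (rotAt y) * c.mat (rotAt y)).trace = 0
    linarith
  have two : ∀ x : V, ‖x‖ = 1 →
      (c.dmat (rotAt x) * (c.mat (rotAt x) * c.mat (rotAt x))).trace = 0 := fun x hx => by
    let y : S3 := ⟨x, by simpa using hx⟩
    have hs := Coeffs.mat_isSymm h.symm_fst h.symm_snd (rotAt y)
    have ht := leftTranslate_mem_tangent y
    have := hI.second y _ (ht ![1, 0, 0]) _ (ht ![0, 1, 0]) _ (ht ![0, 0, 1])
    simp only [h.apply_leftTranslate hK y, h.inner_nijenhuis hK y, hs.eq] at this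
    rw [torsionForm_cyclic_mulVec hs, tr0 y hx, one y hx] at this
    change (c.dmat (rotAt y) * (c.mat (rotAt y) * c.mat (rotAt y))).trace = 0
    linarith
  refine Coeffs.integrable_of_trace_eq_zero h.symm_fst h.symm_snd h.trace_eq
    (fun x hx => ?_) (fun x hx => ?_)
  · have hs := Coeffs.mat_isSymm h.symm_fst h.symm_snd (rotAt x)
    have := one x hx
    rwa [anti, add_mul, trace_add, trace_mul_eq_zero_of_symm (anti' _) hs.eq, add_zero] at this
  · have hs := Coeffs.mat_isSymm h.symm_fst h.symm_snd (rotAt x)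
    have := two x hx
    rwa [anti, add_mul, trace_add, trace_mul_eq_zero_of_symm (anti' _) (by
      rw [transpose_mul, hs.eq]), add_zero] at this

theorem leftTranslate_injective {x : V} (hx : ‖x‖ = 1) : Function.Injective (leftTranslate x) :=
  Function.LeftInverse.injective (leftPart_leftTranslate hx)

/-- Every rotation is the rotation of some point of the sphere (`exists_rotAt`), so pointwise
commutation covers all `φ`. -/
theorem Coeffs.Represents.commuting {c c' : Coeffs} {K K' : Field} (h : c.Represents K)
    (h' : c'.Represents K') (hK : IsSymmetricTensorField K) (hK' : IsSymmetricTensorField K')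
    (hc : ∀ x, K x ∘L K' x = K' x ∘L K x) : c.Commuting c' := by
  intro φ hφ hφ'
  obtain ⟨x, hx, rfl⟩ := exists_rotAt hφ hφ'
  have hs := (Coeffs.mat_isSymm h.symm_fst h.symm_snd (rotAt x)).eq
  have hs' := (Coeffs.mat_isSymm h'.symm_fst h'.symm_snd (rotAt x)).eq
  let y : S3 := ⟨x, by simpa using hx⟩
  refine Matrix.ext_of_mulVec_single fun i => leftTranslate_injective hx ?_
  have h0 := DFunLike.congr_fun (hc y) (leftTranslate y (Pi.single i 1))
  simp only [ContinuousLinearMap.comp_apply, h.apply_leftTranslate hK y,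
    h'.apply_leftTranslate hK' y] at h0
  change leftTranslate x ((c.mat (rotAt x))ᵀ *ᵥ (c'.mat (rotAt x))ᵀ *ᵥ _)
    = leftTranslate x ((c'.mat (rotAt x))ᵀ *ᵥ (c.mat (rotAt x))ᵀ *ᵥ _) at h0
  rwa [hs, hs', mulVec_mulVec, mulVec_mulVec] at h0

/-! ### The Weyl part of a field -/

def tetraPoint (i : Fin 12) : S3 := ⟨tetra i, by simpa using norm_tetra i⟩

/-- The self-dual Weyl part of a field, as a linear map. -/
def weyl : Field →ₗ[ℝ] M3 where
  toFun K := traceFree (∑ i, of fun a b => ⟪K (tetraPoint i)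
    (leftTranslate (tetra i) (Pi.single a 1)), leftTranslate (tetra i) (Pi.single b 1)⟫_ℝ)
  map_add' K K' := by
    rw [← map_add, ← Finset.sum_add_distrib]
    congr 2
    ext i a b
    simp [inner_add_left]
  map_smul' r K := by
    rw [← map_smul, Finset.smul_sum]
    congr 2
    ext i a b
    simp [real_inner_smul_left]

/-- The tetrahedral sum kills the mixed block and makes the anti-self-dual one scalar, which the
trace-free part discards. Thus the Weyl part is linear in `K` with no choice of coefficients. -/
theorem Coeffs.Represents.weyl_eq {c : Coeffs} {K : Field} (h : c.Represents K) :
    weyl K = (12 : ℝ) • traceFree c.1 := by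
  have e : ∀ i, (of fun a b => ⟪K (tetraPoint i) (leftTranslate (tetra i) (Pi.single a 1)),
      leftTranslate (tetra i) (Pi.single b 1)⟫_ℝ) = c.mat (rotAt (tetra i)) := fun i => by
    ext a b
    have := h.inner_apply (tetraPoint i) (Pi.single a 1) (Pi.single b 1)
    simp only [tetraPoint] at this ⊢
    simp [this]
  have hz : ∑ i, (rotAt (tetra i))ᵀ = 0 := by rw [← transpose_sum, sum_rotAt_tetra, transpose_zero]
  have hsum : ∑ i, c.mat (rotAt (tetra i)) = (12 : ℝ) • c.1 + (4 * c.2.1.trace) • (1 : M3) := by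
    simp only [Coeffs.mat, Finset.sum_add_distrib, sum_conj_rotAt_tetra, ← Finset.mul_sum,
      ← Finset.sum_mul, sum_rotAt_tetra, hz, Finset.sum_const, Finset.card_univ, Fintype.card_fin]
    simp [← Nat.cast_smul_eq_nsmul ℝ]
  change traceFree _ = _
  simp only [e]
  rw [hsum, map_add, map_smul, map_smul, traceFree_one, smul_zero, add_zero]

/-! ### The metric -/

theorem contMDiff_of_contDiff {F : Type*} [NormedAddCommGroup F] [NormedSpace ℝ F] {f : V → F}
    (hf : ContDiff ℝ ∞ f) : ContMDiff (𝓡 3) 𝓘(ℝ, F) ∞ (fun x : S3 => f x) := by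
  have : Fact (Module.finrank ℝ V = 3 + 1) := ⟨by simp⟩
  exact hf.contMDiff.comp contMDiff_coe_sphere

theorem P_eq (x : S3) :
    P x = ContinuousLinearMap.id ℝ V - (innerSL ℝ (x : V)).smulRight (x : V) := by
  ext1 v
  simp [P_apply]

theorem contMDiff_metric : ContMDiff (𝓡 3) 𝓘(ℝ, V →L[ℝ] V) ∞ metric := by
  have h1 : ContDiff ℝ ∞ fun y : V => (innerSL ℝ y : V →L[ℝ] ℝ) :=
    ContinuousLinearMap.contDiff (E := V) (F := V →L[ℝ] ℝ) (innerSL ℝ)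
  have h2 : ContDiff ℝ ∞ fun y : V => ContinuousLinearMap.id ℝ V - (innerSL ℝ y).smulRight y := by
    fun_prop
  have : metric = fun x : S3 => ContinuousLinearMap.id ℝ V - (innerSL ℝ (x : V)).smulRight (x : V) :=
    funext P_eq
  rw [this]
  exact contMDiff_of_contDiff h2

theorem isSymmetricTensorField_metric : IsSymmetricTensorField metric where
  smooth := contMDiff_metric
  symmetric := inner_P_left
  normal x := by
    rw [metric, P_apply, real_inner_self_eq_norm_sq, norm_coe_sphere]; simp

/-- The coefficients of the metric. -/
def metricCoeffs : Coeffs := ((1 / 2 : ℝ) • 1, (1 / 2 : ℝ) • 1, 0)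

theorem form_metricCoeffs (x v y w : V) :
    metricCoeffs.form x v y w = ⟪x, y⟫_ℝ * ⟪v, w⟫_ℝ - ⟪x, w⟫_ℝ * ⟪v, y⟫_ℝ := by
  simp [Coeffs.form, metricCoeffs, inner_eq_sum, smul_mulVec, dotProduct, Fin.sum_univ_three,
    leftPart, rightPart]
  ring

theorem represents_metric : metricCoeffs.Represents metric where
  symm_fst := by simp [metricCoeffs, IsSymm]
  symm_snd := by simp [metricCoeffs, IsSymm]
  trace_eq := rfl
  apply x v w := by
    rw [form_metricCoeffs, real_inner_self_eq_norm_sq, norm_coe_sphere, metric, P_apply,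
      inner_sub_left, real_inner_smul_left, real_inner_comm v]
    ring

theorem inner_D_metric {x : S3} {u : V} (hu : u ∈ tangent x) (v w : V) :
    ⟪D metric x u v, w⟫_ℝ = -(⟪u, w⟫_ℝ * ⟪(x : V), v⟫_ℝ + ⟪(x : V), w⟫_ℝ * ⟪u, v⟫_ℝ) := by
  rw [represents_metric.inner_D isSymmetricTensorField_metric hu, form_metricCoeffs,
    form_metricCoeffs, mem_tangent.mp hu, real_inner_comm (x : V) u, mem_tangent.mp hu,
    real_inner_comm v, real_inner_comm v]
  ring

/-! ### Special Killing tensors have no Weyl part -/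

/-- The trace as a continuous linear map. -/
def traceCLM : (V →L[ℝ] V) →L[ℝ] ℝ :=
  LinearMap.toContinuousLinearMap ((LinearMap.trace ℝ V) ∘ₗ ContinuousLinearMap.coeLM ℝ)

theorem contMDiff_tr {A : Field} (hA : ContMDiff (𝓡 3) 𝓘(ℝ, V →L[ℝ] V) ∞ A) :
    ContMDiff (𝓡 3) 𝓘(ℝ, ℝ) ∞ (tr A) :=
  traceCLM.contDiff.contMDiff.comp hA

theorem hasDerivAt_line (x u : V) : HasDerivAt (fun t : ℝ => x + t • u) u 0 := by
  simpa using ((hasDerivAt_id (0 : ℝ)).smul_const u).const_add x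

/-- The product rule for `L - (tr L) g`, where the metric is parallel: by `inner_D_metric` the
tangential part of its derivative vanishes. -/
theorem IsSpecialConformalKillingTensor.inner_nabla {K L : Field}
    (hL : IsSpecialConformalKillingTensor L) (hK : IsSymmetricTensorField K)
    (h : ∀ x : S3, K x = L x - tr L x • metric x) {x : S3} {u v w : V} (hu : u ∈ tangent x)
    (hv : v ∈ tangent x) (hw : w ∈ tangent x) :
    ⟪nabla K x u v, w⟫_ℝ = (1 / 2 : ℝ) * D (tr L) x v * ⟪w, u⟫_ℝ
      + (1 / 2 : ℝ) * D (tr L) x w * ⟪v, u⟫_ℝ - D (tr L) x u * ⟪v, w⟫_ℝ := by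
  rw [← hL.sinjukov x u hu v hv w hw, RoundSphere.inner_nabla _ _ hv hw,
    RoundSphere.inner_nabla _ _ hv hw]
  have hc := hasDerivAt_line (x : V) u
  have h0 : (x : V) + (0 : ℝ) • u = x := by simp
  have h1 := hasDerivAt_radialExt hK.smooth h0 hc
  have h2 := hasDerivAt_radialExt hL.smooth h0 hc
  have h3 := hasDerivAt_radialExt (contMDiff_tr hL.smooth) h0 hc
  have h4 := hasDerivAt_radialExt contMDiff_metric h0 hc
  have h5 := h2.sub (h3.smul h4)
  have e : ∀ᶠ t in nhds (0 : ℝ), radialExt K ((x : V) + t • u) = radialExt L ((x : V) + t • u)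
      - radialExt (tr L) ((x : V) + t • u) • radialExt metric ((x : V) + t • u) := by
    have hne : ∀ᶠ t in nhds (0 : ℝ), (x : V) + t • u ≠ 0 :=
      hc.continuousAt.eventually_ne (by rw [h0]; exact ne_zero_of_mem_unit_sphere x)
    filter_upwards [hne] with t ht
    obtain ⟨y, hy⟩ := exists_smul_eq ht
    have hp := norm_pos_iff.mpr ht
    rw [hy, radialExt_smul _ _ hp, radialExt_smul _ _ hp, radialExt_smul _ _ hp,
      radialExt_smul _ _ hp, h]
  have h6 := h1.unique (h5.congr_of_eventuallyEq e)
  rw [h6, h0, radialExt_coe, radialExt_coe]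
  simp only [_root_.sub_apply, _root_.add_apply, _root_.smul_apply, inner_sub_left, inner_add_left,
    real_inner_smul_left, inner_D_metric hu, mem_tangent.mp hv, mem_tangent.mp hw]
  rw [metric, P_apply_of_mem hv]
  ring

/-- The Sinjukov equation forces the symmetric part of the derivative matrix to vanish. -/
theorem symm_part_eq_zero {X : M3} {l : Fin 3 → ℝ} (htr : X.trace = 0)
    (h : ∀ a b d : Fin 3 → ℝ, nablaForm X a b d
      = (l ⬝ᵥ b) * (d ⬝ᵥ a) + (l ⬝ᵥ d) * (b ⬝ᵥ a) - 2 * (l ⬝ᵥ a) * (b ⬝ᵥ d)) :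
    X + Xᵀ = 0 := by
  have e1 := h ![1, 0, 0] ![0, 1, 0] ![0, 0, 1]
  have e2 := h ![0, 1, 0] ![0, 0, 1] ![1, 0, 0]
  have f1 := h ![1, 0, 0] ![0, 1, 0] ![0, 1, 0]
  have f2 := h ![1, 0, 0] ![0, 0, 1] ![0, 0, 1]
  have f3 := h ![0, 1, 0] ![1, 0, 0] ![1, 0, 0]
  have f4 := h ![0, 1, 0] ![0, 0, 1] ![0, 0, 1]
  have f5 := h ![0, 0, 1] ![1, 0, 0] ![1, 0, 0]
  have f6 := h ![0, 0, 1] ![0, 1, 0] ![0, 1, 0]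
  clear h
  simp [nablaForm, mulVec, dotProduct, cross_apply, Fin.sum_univ_three] at e1 e2 f1 f2 f3 f4 f5 f6
  rw [trace_fin_three] at htr
  ext i j
  fin_cases i <;> fin_cases j <;> simp <;> linarith

theorem D_eq_linear {f : S3 → ℝ} (x : S3) : ∃ l : Fin 3 → ℝ, ∀ a : Fin 3 → ℝ,
    D f x (leftTranslate x a) = l ⬝ᵥ a := by
  have hlin : ∀ a : Fin 3 → ℝ, leftTranslate (x : V) a = a 0 • leftTranslate (x : V) ![1, 0, 0]
      + a 1 • leftTranslate (x : V) ![0, 1, 0] + a 2 • leftTranslate (x : V) ![0, 0, 1] := by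
    intro a
    ext i
    fin_cases i <;> simp [leftTranslate] <;> ring
  refine ⟨![D f x (leftTranslate (x : V) ![1, 0, 0]), D f x (leftTranslate (x : V) ![0, 1, 0]),
    D f x (leftTranslate (x : V) ![0, 0, 1])], fun a => ?_⟩
  rw [hlin a]
  simp only [D, map_add, map_smul, smul_eq_mul, dotProduct, Fin.sum_univ_three, cons_val_zero,
    cons_val_one, cons_val]
  ring

theorem trace_dmat_eq_zero {c : Coeffs} (h : c.1.trace = c.2.1.trace) {φ : M3} (hφ : φᵀ * φ = 1) :
    (c.dmat φ).trace = 0 := by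
  have : (φᵀ * c.2.2ᵀ).trace = (c.2.2 * φ).trace := by
    rw [← transpose_mul, trace_transpose]
  simp [Coeffs.dmat, trace_add, trace_sub, trace_conj hφ, this, h]

/-- Special Killing tensors have no Weyl part. -/
theorem IsSpecialKillingTensor.weyl_eq_zero {K : Field} (hK : IsSpecialKillingTensor K) :
    weyl K = 0 := by
  obtain ⟨hK, L, hL, hKL⟩ := hK
  obtain ⟨c, hc⟩ := hK.exists_represents
  have hKs := hK.toIsSymmetricTensorField
  have conj_eq : ∀ i, (rotAt (tetra i))ᵀ * c.2.1 * rotAt (tetra i) = c.1 := by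
    intro i
    have ht := leftTranslate_mem_tangent (tetraPoint i)
    obtain ⟨l, hl⟩ := D_eq_linear (f := tr L) (tetraPoint i)
    -- Half of this sum is `p - φᵀmφ`. Its vanishing at all twelve points, averaged, makes `p`
    -- scalar.
    have hX : c.dmat (rotAt (tetra i)) + (c.dmat (rotAt (tetra i)))ᵀ = 0 := by
      refine symm_part_eq_zero (l := (1 / 2 : ℝ) • l)
        (trace_dmat_eq_zero hc.trace_eq (rotAt_transpose_mul (norm_tetra i))) fun a b d => ?_
      have h1 := hL.inner_nabla hKs hKL (ht a) (ht b) (ht d)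
      rw [hc.inner_nabla hKs, hl, hl, hl] at h1
      simp only [inner_leftTranslate (norm_coe_sphere (tetraPoint i))] at h1
      rw [smul_dotProduct, smul_dotProduct, smul_dotProduct, nablaForm]
      simp only [smul_eq_mul]
      refine h1.trans ?_
      ring
    have hp := hc.symm_fst.eq
    have hm := hc.symm_snd.eq
    simp only [Coeffs.dmat, transpose_add, transpose_sub, transpose_mul, transpose_transpose, hp,
      hm, ← mul_assoc] at hX
    have h2 : (2 : ℝ) • (c.1 - (rotAt (tetra i))ᵀ * c.2.1 * rotAt (tetra i)) = 0 := by
      rw [← hX]; module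
    have h3 := (smul_eq_zero.mp h2).resolve_left two_ne_zero
    exact (sub_eq_zero.mp h3).symm
  have hsum : (12 : ℝ) • c.1 = (4 * c.2.1.trace) • (1 : M3) := by
    rw [← sum_conj_rotAt_tetra, Finset.sum_congr rfl fun i _ => conj_eq i]
    simp [← Nat.cast_smul_eq_nsmul ℝ]
  rw [hc.weyl_eq, ← map_smul, hsum, map_smul, traceFree_one, smul_zero]

/-! ### Killing tensors without Weyl part -/

theorem eq_smul_one_of_traceFree {A : M3} (h : traceFree A = 0) : A = (A.trace / 3) • (1 : M3) := by
  rwa [traceFree_apply, sub_eq_zero] at h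

theorem eq_zero_of_trace_mul_self {A : M3} (hA : A.IsSymm) (h : (A * A).trace = 0) : A = 0 := by
  have : (Aᵀ * A).trace = 0 := by rwa [hA.eq]
  rwa [← conjTranspose_eq_transpose_of_trivial, trace_conjTranspose_mul_self_eq_zero_iff] at this

/-- Equality of the first two power sums gives the trace-free part of `m` the same norm as that of
`p`, namely zero. -/
theorem Coeffs.Integrable.eq_smul_one {c : Coeffs} (hc : c.Integrable) (h : traceFree c.1 = 0) :
    ∃ t : ℝ, c.1 = t • 1 ∧ c.2.1 = t • 1 := by
  have h1 := eq_smul_one_of_traceFree h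
  refine ⟨_, h1, ?_⟩
  rw [← sub_eq_zero]
  set t := c.1.trace / 3 with ht
  have hm : c.2.1.trace = 3 * t := by rw [← hc.trace_one, ht]; ring
  have h2 := hc.trace_two
  rw [h1] at h2
  refine eq_zero_of_trace_mul_self ?_ ?_
  · rw [IsSymm, transpose_sub, hc.symm_snd.eq]; simp
  · simp [mul_sub, sub_mul, hm, ← h2]
    ring

/-- The field `v ↦ P A v + ⟪A x, x⟫ v` given by an endomorphism `A` of the ambient space. -/
def ofEndo (A : V →L[ℝ] V) : Field := fun x =>
  P x ∘L A ∘L P x + ⟪A x, (x : V)⟫_ℝ • P x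

theorem ofEndo_smul_add (r s : ℝ) (A : V →L[ℝ] V) :
    ofEndo (r • A + s • ContinuousLinearMap.id ℝ V) = r • ofEndo A + (2 * s) • metric := by
  ext1 x
  ext1 v
  have hPP : P x (P x v) = P x v := P_apply_of_mem (Submodule.starProjection_apply_mem _ _)
  simp [ofEndo, metric, hPP, inner_add_left, real_inner_smul_left]
  module

/-- The symmetric endomorphism of the ambient space given by the mixed block of coefficients. -/
def mixedEndo (z : M3) (t : ℝ) : V →L[ℝ] V :=
  Matrix.toEuclideanCLM (n := Fin 4) (𝕜 := ℝ)
    !![z.trace + t, z 1 2 - z 2 1, z 2 0 - z 0 2, z 0 1 - z 1 0;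
      z 1 2 - z 2 1, 2 * z 0 0 + t - z.trace, z 0 1 + z 1 0, z 0 2 + z 2 0;
      z 2 0 - z 0 2, z 0 1 + z 1 0, 2 * z 1 1 + t - z.trace, z 1 2 + z 2 1;
      z 0 1 - z 1 0, z 0 2 + z 2 0, z 1 2 + z 2 1, 2 * z 2 2 + t - z.trace]

theorem mixedEndo_apply (z : M3) (t : ℝ) (v : V) : mixedEndo z t v = !₂[
    (z.trace + t) * v 0 + (z 1 2 - z 2 1) * v 1 + (z 2 0 - z 0 2) * v 2 + (z 0 1 - z 1 0) * v 3,
    (z 1 2 - z 2 1) * v 0 + (2 * z 0 0 + t - z.trace) * v 1 + (z 0 1 + z 1 0) * v 2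
      + (z 0 2 + z 2 0) * v 3,
    (z 2 0 - z 0 2) * v 0 + (z 0 1 + z 1 0) * v 1 + (2 * z 1 1 + t - z.trace) * v 2
      + (z 1 2 + z 2 1) * v 3,
    (z 0 1 - z 1 0) * v 0 + (z 0 2 + z 2 0) * v 1 + (z 1 2 + z 2 1) * v 2
      + (2 * z 2 2 + t - z.trace) * v 3] := by
  ext i
  rw [mixedEndo, Matrix.ofLp_toEuclideanCLM]
  fin_cases i <;> simp [mulVec, dotProduct, Fin.sum_univ_four]

theorem mixedEndo_symmetric (z : M3) (t : ℝ) (v w : V) :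
    ⟪mixedEndo z t v, w⟫_ℝ = ⟪v, mixedEndo z t w⟫_ℝ := by
  simp only [inner_eq_sum, mixedEndo_apply, cons_val_zero, cons_val_one, cons_val]
  ring

/-- Without Weyl part the curvature tensor is the Kulkarni–Nomizu product of the metric with a
symmetric endomorphism: the mixed block is its trace-free part and `t` a quarter of its trace. -/
theorem form_eq_mixedEndo (z : M3) (t : ℝ) (x v w : V) :
    Coeffs.form (t • 1, t • 1, z) x v x w = ⟪x, x⟫_ℝ * ⟪mixedEndo z t v, w⟫_ℝ
      + ⟪mixedEndo z t x, x⟫_ℝ * ⟪v, w⟫_ℝ - ⟪mixedEndo z t x, w⟫_ℝ * ⟪x, v⟫_ℝ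
      - ⟪x, w⟫_ℝ * ⟪mixedEndo z t v, x⟫_ℝ := by
  have h1 : leftPart x v ⬝ᵥ leftPart x w + rightPart x v ⬝ᵥ rightPart x w
      = 2 * (⟪x, x⟫_ℝ * ⟪v, w⟫_ℝ - ⟪x, w⟫_ℝ * ⟪x, v⟫_ℝ) := by
    simp only [dotProduct, Fin.sum_univ_three, leftPart, rightPart, cons_val_zero, cons_val_one,
      cons_val, inner_eq_sum]
    ring
  have h2 : Coeffs.form (t • 1, t • 1, z) x v x w
      = t * (leftPart x v ⬝ᵥ leftPart x w + rightPart x v ⬝ᵥ rightPart x w)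
        + (leftPart x v ⬝ᵥ z *ᵥ rightPart x w + rightPart x v ⬝ᵥ zᵀ *ᵥ leftPart x w) := by
    simp only [Coeffs.form, smul_mulVec, one_mulVec, dotProduct_smul, smul_eq_mul]
    ring
  rw [h2, h1]
  simp only [dotProduct, mulVec, Fin.sum_univ_three, transpose_apply]
  simp only [leftPart, rightPart, cons_val_zero, cons_val_one, cons_val]
  simp only [inner_eq_sum, mixedEndo_apply, cons_val_zero, cons_val_one, cons_val, trace_fin_three]
  ring

/-- Integrable Killing tensors without Weyl part come from endomorphisms of the ambient space. -/
theorem Coeffs.Represents.exists_eq_ofEndo {c : Coeffs} {K : Field} (h : c.Represents K)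
    (hc : c.Integrable) (hw : weyl K = 0) :
    ∃ A : V →L[ℝ] V, (∀ v w, ⟪A v, w⟫_ℝ = ⟪v, A w⟫_ℝ) ∧ K = ofEndo A := by
  rw [h.weyl_eq] at hw
  obtain ⟨t, hp, hm⟩ := hc.eq_smul_one ((smul_eq_zero.mp hw).resolve_left (by norm_num))
  obtain ⟨p, m, z⟩ := c
  simp only at hp hm
  subst hp hm
  refine ⟨mixedEndo z t, mixedEndo_symmetric z t, ?_⟩
  ext1 x
  ext1 v
  refine ext_inner_right ℝ fun w => ?_
  have hx : ⟪(x : V), x⟫_ℝ = 1 := by rw [real_inner_self_eq_norm_sq, norm_coe_sphere]; norm_num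
  have hs := mixedEndo_symmetric z t v x
  have hs' := real_inner_comm v (mixedEndo z t x)
  rw [h.apply, form_eq_mixedEndo, hx]
  simp only [ofEndo, P_apply, _root_.add_apply, _root_.smul_apply, ContinuousLinearMap.comp_apply,
    map_sub, map_smul, inner_add_left, inner_sub_left, real_inner_smul_left,
    real_inner_comm (mixedEndo z t v), real_inner_comm (mixedEndo z t x)]
  ring

/-! ### Special Killing tensors from ambient endomorphisms -/

/-- The tangential part of an endomorphism of the ambient space. -/
def tangentialPart (B : V →L[ℝ] V) : Field := fun x => P x ∘L B ∘L P x

theorem P_P (x : S3) (v : V) : P x (P x v) = P x v :=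
  P_apply_of_mem (Submodule.starProjection_apply_mem _ _)

theorem inner_coe_self (x : S3) : ⟪(x : V), x⟫_ℝ = 1 := by
  rw [real_inner_self_eq_norm_sq, norm_coe_sphere]; norm_num

theorem tr_tangentialPart (B : V →L[ℝ] V) (x : S3) :
    tr (tangentialPart B) x = LinearMap.trace ℝ V B - ⟪B x, (x : V)⟫_ℝ := by
  have h1 : ((tangentialPart B x : V →L[ℝ] V) : V →ₗ[ℝ] V)
      = (P x : V →ₗ[ℝ] V) ∘ₗ ((B : V →ₗ[ℝ] V) ∘ₗ (P x : V →ₗ[ℝ] V)) := rfl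
  have h2 : ((B : V →ₗ[ℝ] V) ∘ₗ (P x : V →ₗ[ℝ] V)) ∘ₗ (P x : V →ₗ[ℝ] V)
      = (B : V →ₗ[ℝ] V) - ((innerSL ℝ (x : V) : V →L[ℝ] ℝ) : V →ₗ[ℝ] ℝ).smulRight (B x) := by
    ext1 v
    simp only [LinearMap.comp_apply, ContinuousLinearMap.coe_coe, P_P, LinearMap.sub_apply,
      LinearMap.smulRight_apply, innerSL_apply_apply]
    rw [P_apply, map_sub, map_smul]
  rw [tr, h1, LinearMap.trace_comp_comm', h2, map_sub, LinearMap.trace_smulRight]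
  simp [real_inner_comm]

theorem eventually_radialExt_line {x : S3} (u : V) {p : V → Prop}
    (h : ∀ (y : S3) (r : ℝ), 0 < r → p (r • (y : V))) :
    ∀ᶠ t in nhds (0 : ℝ), p ((x : V) + t • u) := by
  have h0 : (x : V) + (0 : ℝ) • u = x := by simp
  have hne : ∀ᶠ t in nhds (0 : ℝ), (x : V) + t • u ≠ 0 :=
    (hasDerivAt_line (x : V) u).continuousAt.eventually_ne
      (by rw [h0]; exact ne_zero_of_mem_unit_sphere x)
  filter_upwards [hne] with t ht
  obtain ⟨y, hy⟩ := exists_smul_eq ht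
  rw [hy]
  exact h y _ (norm_pos_iff.mpr ht)

theorem contMDiff_tangentialPart (B : V →L[ℝ] V) :
    ContMDiff (𝓡 3) 𝓘(ℝ, V →L[ℝ] V) ∞ (tangentialPart B) :=
  contMDiff_metric.clm_comp (contMDiff_const.clm_comp contMDiff_metric)

theorem D_tr_tangentialPart {B : V →L[ℝ] V} (hB : ∀ v w, ⟪B v, w⟫_ℝ = ⟪v, B w⟫_ℝ) {x : S3} {v : V}
    (hv : v ∈ tangent x) : D (tr (tangentialPart B)) x v = -2 * ⟪(x : V), B v⟫_ℝ := by
  have hc := hasDerivAt_line (x : V) v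
  have h0 : (x : V) + (0 : ℝ) • v = x := by simp
  have h1 := hasDerivAt_radialExt (contMDiff_tr (contMDiff_tangentialPart B)) h0 hc
  have h2 := hc.norm_sq.mul h1
  have h3 := (hc.norm_sq.mul_const (LinearMap.trace ℝ V B)).sub
    ((B.hasFDerivAt.comp_hasDerivAt _ hc).inner ℝ hc)
  have e := eventually_radialExt_line (x := x) v
    (p := fun y => ‖y‖ ^ 2 * radialExt (tr (tangentialPart B)) y
      = ‖y‖ ^ 2 * LinearMap.trace ℝ V B - ⟪B y, y⟫_ℝ) fun y r hr => by
    rw [radialExt_smul _ _ hr, tr_tangentialPart, norm_smul, norm_coe_sphere, map_smul,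
      real_inner_smul_left, real_inner_smul_right, Real.norm_of_nonneg hr.le]
    ring
  have h4 := h2.unique (h3.congr_of_eventuallyEq e)
  simp only [h0, norm_coe_sphere, mem_tangent.mp hv, Function.comp_apply, hB v,
    real_inner_comm v (B x)] at h4
  rw [real_inner_comm, hB] at h4 
  linear_combination h4

theorem inner_D_tangentialPart {B : V →L[ℝ] V} (hB : ∀ v w, ⟪B v, w⟫_ℝ = ⟪v, B w⟫_ℝ) {x : S3}
    {u v w : V} (hu : u ∈ tangent x) (hv : v ∈ tangent x) (hw : w ∈ tangent x) :
    ⟪D (tangentialPart B) x u v, w⟫_ℝ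
      = -(⟪u, w⟫_ℝ * ⟪(x : V), B v⟫_ℝ) - ⟪(x : V), B w⟫_ℝ * ⟪u, v⟫_ℝ := by
  have hc := hasDerivAt_line (x : V) u
  have h0 : (x : V) + (0 : ℝ) • u = x := by simp
  have h1 := hasDerivAt_radialExt (contMDiff_tangentialPart B) h0 hc
  have h2 := hasDerivAt_radialExt contMDiff_metric h0 hc
  have h3 := h2.clm_comp ((hasDerivAt_const (0 : ℝ) B).clm_comp h2)
  have e := eventually_radialExt_line (x := x) u
    (p := fun y => radialExt (tangentialPart B) y
      = radialExt metric y ∘L (B ∘L radialExt metric y)) fun y r hr => by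
    rw [radialExt_smul _ _ hr, radialExt_smul _ _ hr]; rfl
  have h4 := h1.unique (h3.congr_of_eventuallyEq e)
  rw [h4, h0, radialExt_coe]
  simp only [metric, _root_.add_apply, ContinuousLinearMap.comp_apply, inner_add_left, inner_P_left,
    P_apply_of_mem hv, P_apply_of_mem hw, hB, _root_.zero_apply, zero_add]
  have h5 := inner_D_metric hu (B v) w
  have h6 := inner_D_metric hu v (B w)
  rw [h5, h6, mem_tangent.mp hv, mem_tangent.mp hw]
  ring

theorem isSpecialConformalKillingTensor_tangentialPart {B : V →L[ℝ] V}
    (hB : ∀ v w, ⟪B v, w⟫_ℝ = ⟪v, B w⟫_ℝ) :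
    IsSpecialConformalKillingTensor (tangentialPart B) where
  smooth := contMDiff_tangentialPart B
  symmetric x v w := by
    simp only [tangentialPart, ContinuousLinearMap.comp_apply, inner_P_left, hB]
  normal x := by
    have := isSymmetricTensorField_metric.normal x
    rw [metric] at this
    simp [tangentialPart, this]
  sinjukov x u hu v hv w hw := by
    rw [inner_nabla _ _ hv hw, inner_D_tangentialPart hB hu hv hw, D_tr_tangentialPart hB hv,
      D_tr_tangentialPart hB hw, real_inner_comm u w, real_inner_comm u v]
    ring

theorem isSpecialKillingTensor_ofEndo {A : V →L[ℝ] V} (hA : ∀ v w, ⟪A v, w⟫_ℝ = ⟪v, A w⟫_ℝ)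
    (hK : IsKillingTensor (ofEndo A)) : IsSpecialKillingTensor (ofEndo A) := by
  -- This shift makes `tr (A + k) = 2k`, so that the multiples of the metric containing `k` cancel
  -- in `L - (tr L) g`.
  set k : ℝ := -(LinearMap.trace ℝ V A) / 2 with hk
  refine ⟨hK, tangentialPart (A + k • ContinuousLinearMap.id ℝ V),
    isSpecialConformalKillingTensor_tangentialPart fun v w => ?_, fun x => ?_⟩
  · simp [inner_add_left, inner_add_right, real_inner_smul_left, real_inner_smul_right, hA]
  · have ht : LinearMap.trace ℝ V ((A + k • ContinuousLinearMap.id ℝ V : V →L[ℝ] V) : V →ₗ[ℝ] V)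
        = 2 * k := by
      have : ((A + k • ContinuousLinearMap.id ℝ V : V →L[ℝ] V) : V →ₗ[ℝ] V)
          = (A : V →ₗ[ℝ] V) + k • LinearMap.id := rfl
      rw [this, map_add, map_smul, LinearMap.trace_id, hk]
      simp
      ring
    rw [tr_tangentialPart, ht]
    ext1 v
    simp only [ofEndo, tangentialPart, metric, _root_.add_apply, _root_.smul_apply,
      ContinuousLinearMap.comp_apply, _root_.sub_apply, map_add, map_smul, inner_add_left,
      real_inner_smul_left, ContinuousLinearMap.id_apply, P_P, inner_coe_self]
    module

/-! ### Commuting fields of ambient endomorphisms -/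

/-- Symmetric maps with everywhere proportional values are proportional. -/
theorem eq_zero_or_exists_eq_smul {B B' : V →L[ℝ] V} (hB : ∀ v w, ⟪B v, w⟫_ℝ = ⟪v, B w⟫_ℝ)
    (hB' : ∀ v w, ⟪B' v, w⟫_ℝ = ⟪v, B' w⟫_ℝ)
    (h : ∀ y v w, ⟪B y, v⟫_ℝ * ⟪B' y, w⟫_ℝ = ⟪B' y, v⟫_ℝ * ⟪B y, w⟫_ℝ) :
    B = 0 ∨ ∃ c : ℝ, B' = c • B := by
  refine or_iff_not_imp_left.mpr fun h0 => ?_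
  obtain ⟨u, hu⟩ : ∃ u, ⟪B u, u⟫_ℝ ≠ 0 := by
    by_contra! hn
    have hs : (B : V →ₗ[ℝ] V).IsSymmetric := hB
    have := hs.inner_map_self_eq_zero.mp hn
    exact h0 (ContinuousLinearMap.coe_injective this)
  set c := ⟪B' u, u⟫_ℝ / ⟪B u, u⟫_ℝ with hc
  have hcu : c * ⟪B u, u⟫_ℝ = ⟪B' u, u⟫_ℝ := by rw [hc]; field_simp
  have hCu : ∀ w, ⟪B' u, w⟫_ℝ = c * ⟪B u, w⟫_ℝ := fun w => by
    have := h u u w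
    rw [← hcu] at this
    refine mul_left_cancel₀ hu ?_
    rw [this]; ring
  refine ⟨c, ?_⟩
  ext1 y
  refine ext_inner_right ℝ fun w => ?_
  rw [_root_.smul_apply, real_inner_smul_left]
  have e : ⟪B' y, u⟫_ℝ = c * ⟪B y, u⟫_ℝ := by
    rw [hB', hB, real_inner_comm (B' u), hCu, real_inner_comm (B u)]
  -- The difference of the relations at `u + y` and `u - y` isolates the terms linear in `y`.
  have h1 := h (u + y) u w
  have h2 := h (u - y) u w
  simp only [map_add, map_sub, inner_add_left, inner_sub_left, hCu, e] at h1 h2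
  refine mul_left_cancel₀ hu ?_
  linear_combination (h1 - h2) / 2

section Commuting

variable {A A' : V →L[ℝ] V}

/-- The multiples of `P` commute with everything, so only the compressions of `A` and `A'` to the
tangent space matter; compression produces the rank-one corrections. -/
theorem inner_swap_of_commute (hA : ∀ v w, ⟪A v, w⟫_ℝ = ⟪v, A w⟫_ℝ)
    (hA' : ∀ v w, ⟪A' v, w⟫_ℝ = ⟪v, A' w⟫_ℝ) {x : S3}
    (hc : ofEndo A x ∘L ofEndo A' x = ofEndo A' x ∘L ofEndo A x) {v w : V} (hv : v ∈ tangent x)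
    (hw : w ∈ tangent x) :
    ⟪A' v, A w⟫_ℝ - ⟪(x : V), A' v⟫_ℝ * ⟪(x : V), A w⟫_ℝ
      = ⟪A v, A' w⟫_ℝ - ⟪(x : V), A v⟫_ℝ * ⟪(x : V), A' w⟫_ℝ := by
  have h := congrArg (fun T : V →L[ℝ] V => ⟪T v, w⟫_ℝ) hc
  simp only [ofEndo, _root_.add_apply, _root_.smul_apply, ContinuousLinearMap.comp_apply, map_add,
    map_smul, inner_add_left, real_inner_smul_left, P_P, P_apply_of_mem hv] at h
  simp only [inner_P_left x _ w, P_apply_of_mem hw, hA _ w, hA' _ w] at h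
  simp only [P_apply, inner_sub_left, real_inner_smul_left] at h
  rw [← hA' v w] at h
  rw [← hA v w] at h
  linear_combination h

/-- For two vectors of an eigenbasis of `A` there is another basis vector orthogonal to both. With
it as base point the corrections vanish. -/
theorem commute_of_commute_ofEndo (hA : ∀ v w, ⟪A v, w⟫_ℝ = ⟪v, A w⟫_ℝ)
    (hA' : ∀ v w, ⟪A' v, w⟫_ℝ = ⟪v, A' w⟫_ℝ)
    (hc : ∀ x, ofEndo A x ∘L ofEndo A' x = ofEndo A' x ∘L ofEndo A x) (v w : V) :
    ⟪A' v, A w⟫_ℝ = ⟪A v, A' w⟫_ℝ := by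
  have hs : (A : V →ₗ[ℝ] V).IsSymmetric := hA
  have hn : Module.finrank ℝ V = 4 := by simp
  let b := hs.eigenvectorBasis hn
  have hb : ∀ i, A (b i) = hs.eigenvalues hn i • b i := fun i => hs.apply_eigenvectorBasis hn i
  have key : ∀ i j, ⟪A' (b i), A (b j)⟫_ℝ = ⟪A (b i), A' (b j)⟫_ℝ := by
    intro i j
    obtain ⟨k, hki, hkj⟩ : ∃ k : Fin 4, k ≠ i ∧ k ≠ j := by revert i j; decide
    let x : S3 := ⟨b k, by simp⟩
    have h1 : ⟪(x : V), b i⟫_ℝ = 0 := b.orthonormal.2 hki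
    have h2 : ⟪(x : V), b j⟫_ℝ = 0 := b.orthonormal.2 hkj
    have := inner_swap_of_commute hA hA' (hc x) (mem_tangent.mpr h1) (mem_tangent.mpr h2)
    rw [hb, hb, real_inner_smul_right (x : V), real_inner_smul_right (x : V), h1, h2,
      real_inner_smul_right] at this
    rw [hb, hb, real_inner_smul_right]
    linear_combination this
  have : (innerₗ V).compl₁₂ (A' : V →ₗ[ℝ] V) (A : V →ₗ[ℝ] V)
      = (innerₗ V).compl₁₂ (A : V →ₗ[ℝ] V) (A' : V →ₗ[ℝ] V) :=
    b.toBasis.ext fun i => b.toBasis.ext fun j => by simpa using key i j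
  exact LinearMap.congr_fun₂ this v w

/-- Once `A` and `A'` commute only the corrections remain: on the complement of `z` the functionals
given by `Az` and `A'z` are proportional. -/
theorem mul_inner_swap (hA : ∀ v w, ⟪A v, w⟫_ℝ = ⟪v, A w⟫_ℝ)
    (hA' : ∀ v w, ⟪A' v, w⟫_ℝ = ⟪v, A' w⟫_ℝ)
    (hc : ∀ x, ofEndo A x ∘L ofEndo A' x = ofEndo A' x ∘L ofEndo A x) {z v w : V}
    (hv : ⟪z, v⟫_ℝ = 0) (hw : ⟪z, w⟫_ℝ = 0) :
    ⟪z, A' v⟫_ℝ * ⟪z, A w⟫_ℝ = ⟪z, A v⟫_ℝ * ⟪z, A' w⟫_ℝ := by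
  obtain rfl | hz := eq_or_ne z 0
  · simp
  obtain ⟨x, hx⟩ := exists_smul_eq hz
  have hr := norm_ne_zero_iff.mpr hz
  generalize ‖z‖ = r at hx hr
  subst hx
  rw [real_inner_smul_left] at hv hw
  have h := inner_swap_of_commute hA hA' (hc x)
    (mem_tangent.mpr ((mul_eq_zero.mp hv).resolve_left hr))
    (mem_tangent.mpr ((mul_eq_zero.mp hw).resolve_left hr))
  rw [commute_of_commute_ofEndo hA hA' hc] at h
  simp only [real_inner_smul_left]
  linear_combination -r ^ 2 * h

theorem exists_common_eigenvector (hA : ∀ v w, ⟪A v, w⟫_ℝ = ⟪v, A w⟫_ℝ)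
    (hA' : ∀ v w, ⟪A' v, w⟫_ℝ = ⟪v, A' w⟫_ℝ)
    (hc : ∀ v w, ⟪A' v, A w⟫_ℝ = ⟪A v, A' w⟫_ℝ) :
    ∃ (e : V) (a a' : ℝ), ⟪e, e⟫_ℝ = 1 ∧ A e = a • e ∧ A' e = a' • e := by
  have hs : (A : V →ₗ[ℝ] V).IsSymmetric := hA
  have hs' : (A' : V →ₗ[ℝ] V).IsSymmetric := hA'
  have hcomm : Commute (A : V →ₗ[ℝ] V) (A' : V →ₗ[ℝ] V) := by
    refine LinearMap.ext fun v => ext_inner_right ℝ fun w => ?_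
    change ⟪A (A' v), w⟫_ℝ = ⟪A' (A v), w⟫_ℝ
    rw [hA, hA' (A v), hc]
  have htop := LinearMap.IsSymmetric.iSup_iSup_eigenspace_inf_eigenspace_eq_top_of_commute hs hs'
    hcomm
  obtain ⟨a, a', h⟩ : ∃ a a', Module.End.eigenspace (A : V →ₗ[ℝ] V) a
      ⊓ Module.End.eigenspace (A' : V →ₗ[ℝ] V) a' ≠ ⊥ := by
    by_contra! hn
    simp only [hn, iSup_bot] at htop
    exact bot_ne_top htop
  obtain ⟨e, ⟨he, he'⟩, hne⟩ := Submodule.exists_mem_ne_zero_of_ne_bot h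
  rw [SetLike.mem_coe, Module.End.mem_eigenspace_iff] at he he'
  obtain ⟨x, hx⟩ := exists_smul_eq hne
  have hr := norm_ne_zero_iff.mpr hne
  refine ⟨x, a, a', inner_coe_self x, ?_, ?_⟩
  · refine smul_right_injective V hr ?_
    change ‖e‖ • A x = ‖e‖ • a • (x : V)
    rw [← map_smul, smul_comm, ← hx]; exact he
  · refine smul_right_injective V hr ?_
    change ‖e‖ • A' x = ‖e‖ • a' • (x : V)
    rw [← map_smul, smul_comm, ← hx]; exact he'

/-- Commuting fields come from endomorphisms that are linearly dependent modulo scalars. -/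
theorem eq_smul_id_or_exists_eq_smul_add (hA : ∀ v w, ⟪A v, w⟫_ℝ = ⟪v, A w⟫_ℝ)
    (hA' : ∀ v w, ⟪A' v, w⟫_ℝ = ⟪v, A' w⟫_ℝ)
    (hc : ∀ x, ofEndo A x ∘L ofEndo A' x = ofEndo A' x ∘L ofEndo A x) :
    (∃ s : ℝ, A = s • ContinuousLinearMap.id ℝ V) ∨
      ∃ r s : ℝ, A' = r • A + s • ContinuousLinearMap.id ℝ V := by
  obtain ⟨e, a, a', he1, he, he'⟩ := exists_common_eigenvector hA hA'
    (commute_of_commute_ofEndo hA hA' hc)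
  have symm_sub : ∀ {T : V →L[ℝ] V} (t : ℝ), (∀ v w, ⟪T v, w⟫_ℝ = ⟪v, T w⟫_ℝ) →
      ∀ v w, ⟪(T - t • ContinuousLinearMap.id ℝ V) v, w⟫_ℝ
        = ⟪v, (T - t • ContinuousLinearMap.id ℝ V) w⟫_ℝ := fun t hT v w => by
    simp [inner_sub_left, inner_sub_right, real_inner_smul_left, real_inner_smul_right, hT]
  have key : ∀ y v w, ⟪(A - a • ContinuousLinearMap.id ℝ V) y, v⟫_ℝ
        * ⟪(A' - a' • ContinuousLinearMap.id ℝ V) y, w⟫_ℝ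
      = ⟪(A' - a' • ContinuousLinearMap.id ℝ V) y, v⟫_ℝ
        * ⟪(A - a • ContinuousLinearMap.id ℝ V) y, w⟫_ℝ := by
    intro y v w
    -- Adding a multiple of `e` is invisible to the shifted maps, which kill `e`. Since `⟪z, e⟫ =
    -- 1`, every vector can be projected along `e` onto the complement of `z`, which removes the
    -- orthogonality constraints.
    set z := y + (1 - ⟪e, y⟫_ℝ) • e with hz
    have hze : ⟪z, e⟫_ℝ = 1 := by
      rw [hz, inner_add_left, real_inner_smul_left, he1, real_inner_comm e y]; ring
    have hperp : ∀ v, ⟪z, v - ⟪z, v⟫_ℝ • e⟫_ℝ = 0 := fun v => by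
      rw [inner_sub_right, real_inner_smul_right, hze]; ring
    have hval : ∀ {T : V →L[ℝ] V} {t : ℝ}, (∀ v w, ⟪T v, w⟫_ℝ = ⟪v, T w⟫_ℝ) → T e = t • e → ∀ v,
        ⟪z, T (v - ⟪z, v⟫_ℝ • e)⟫_ℝ = ⟪(T - t • ContinuousLinearMap.id ℝ V) y, v⟫_ℝ := by
      intro T t hT ht v
      have h1 : ⟪(T - t • ContinuousLinearMap.id ℝ V) y, v⟫_ℝ
          = ⟪(T - t • ContinuousLinearMap.id ℝ V) z, v⟫_ℝ := by
        congr 1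
        rw [hz, map_add, map_smul]
        simp [ht]
      rw [h1, map_sub, map_smul, ht, inner_sub_right, real_inner_smul_right, real_inner_smul_right,
        hze, ← hT, _root_.sub_apply, inner_sub_left, _root_.smul_apply, real_inner_smul_left,
        ContinuousLinearMap.id_apply]
      ring
    have := mul_inner_swap hA hA' hc (hperp v) (hperp w)
    rw [hval hA he, hval hA' he', hval hA he, hval hA' he'] at this
    exact this.symm
  obtain h | ⟨c, h⟩ := eq_zero_or_exists_eq_smul (symm_sub a hA) (symm_sub a' hA') key
  · exact Or.inl ⟨a, sub_eq_zero.mp h⟩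
  · refine Or.inr ⟨c, a' - c * a, ?_⟩
    rw [sub_eq_iff_eq_add.mp h]
    module

end Commuting

/-! ### Adjoining the metric, not yet known to lie in the system -/

theorem ofEndo_smul_id (s : ℝ) : ofEndo (s • ContinuousLinearMap.id ℝ V) = (2 * s) • metric := by
  ext1 x
  ext1 v
  simp [ofEndo, metric, P_P, real_inner_smul_left]
  module

theorem IsSymmetricTensorField.add_smul {K K' : Field} (h : IsSymmetricTensorField K)
    (h' : IsSymmetricTensorField K') (t : ℝ) : IsSymmetricTensorField (K + t • K') where
  smooth := h.smooth.add (((ContinuousLinearMap.id ℝ _).contDiff.const_smul t).contMDiff.comp h'.smooth)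
  symmetric x v w := by
    simp [inner_add_left, inner_add_right, real_inner_smul_left, real_inner_smul_right,
      h.symmetric, h'.symmetric]
  normal x := by simp [h.normal, h'.normal]

theorem Coeffs.add_form (c c' : Coeffs) (x v y w : V) :
    (c + c').form x v y w = c.form x v y w + c'.form x v y w := by
  simp only [Coeffs.form, Prod.fst_add, Prod.snd_add, transpose_add, add_mulVec, dotProduct_add]
  ring

theorem Coeffs.smul_form (t : ℝ) (c : Coeffs) (x v y w : V) :
    (t • c).form x v y w = t * c.form x v y w := by
  simp only [Coeffs.form, Prod.smul_fst, Prod.smul_snd, transpose_smul, smul_mulVec,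
    dotProduct_smul, smul_eq_mul]
  ring

theorem Coeffs.Represents.smul {c : Coeffs} {K : Field} (h : c.Represents K) (t : ℝ) :
    (t • c).Represents (t • K) where
  symm_fst := h.symm_fst.smul t
  symm_snd := h.symm_snd.smul t
  trace_eq := by simp [h.trace_eq]
  apply x v w := by
    simp [real_inner_smul_left, Coeffs.smul_form, h.apply]

theorem Coeffs.Represents.add {c c' : Coeffs} {K K' : Field} (h : c.Represents K)
    (h' : c'.Represents K') : (c + c').Represents (K + K') where
  symm_fst := h.symm_fst.add h'.symm_fst
  symm_snd := h.symm_snd.add h'.symm_snd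
  trace_eq := by simp [h.trace_eq, h'.trace_eq]
  apply x v w := by
    simp [inner_add_left, Coeffs.add_form, h.apply, h'.apply]

theorem Coeffs.Integrable.add_smul_metricCoeffs {c : Coeffs} (h : c.Integrable) (t : ℝ) :
    (c + t • metricCoeffs).Integrable := by
  have h1 := h.trace_one
  have h2 := h.trace_two
  have h3 := h.trace_three
  have h4 := h.intertwine
  constructor
  · exact h.symm_fst.add ((isSymm_one.smul _).smul t)
  · exact h.symm_snd.add ((isSymm_one.smul _).smul t)
  · simp [metricCoeffs, h1]
  · simp [metricCoeffs, mul_add, add_mul, h1, h2]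
  · simp [metricCoeffs, mul_add, add_mul, h1, h2, h3]
  · simp [metricCoeffs, mul_add, add_mul, h4]

/-- The algebraic integrability conditions are insensitive to adding the metric, so they extend to
the enlarged space without computing its torsion. -/
theorem Coeffs.Represents.integrable_of_add_smul_metric {c : Coeffs} {K : Field} {t : ℝ}
    (h : c.Represents (K + t • metric)) (hK : IsSymmetricTensorField K) (hI : IsIntegrable K) :
    c.Integrable := by
  have h1 := h.add (represents_metric.smul (-t))
  have h2 : K + t • metric + -t • metric = K := by module
  rw [h2] at h1
  have h3 := (h1.integrable hK hI).add_smul_metricCoeffs t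
  have h4 : c + -t • metricCoeffs + t • metricCoeffs = c := by module
  rwa [h4] at h3

theorem IsSymmetricTensorField.comp_metric {K : Field} (h : IsSymmetricTensorField K) (x : S3) :
    K x ∘L metric x = K x := by
  ext1 v
  simp [metric, P_apply, h.normal]

theorem IsSymmetricTensorField.metric_comp {K : Field} (h : IsSymmetricTensorField K) (x : S3) :
    metric x ∘L K x = K x := by
  ext1 v
  have : ⟪(x : V), K x v⟫_ℝ = 0 := by rw [← h.symmetric, h.normal, inner_zero_left]
  simp [metric, P_apply, this]

section

variable {S : Submodule ℝ Field} {T T' : Field}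

/-- The span of a space of fields and the metric. -/
def withMetric (S : Submodule ℝ Field) : Submodule ℝ Field := S ⊔ Submodule.span ℝ {metric}

theorem mem_withMetric : T ∈ withMetric S ↔ ∃ K ∈ S, ∃ t : ℝ, T = K + t • metric := by
  rw [withMetric, Submodule.mem_sup]
  simp only [Submodule.mem_span_singleton, exists_exists_eq_and]
  exact exists_congr fun K => and_congr_right fun _ => exists_congr fun t => eq_comm

theorem metric_mem_withMetric : metric ∈ withMetric S :=
  Submodule.mem_sup_right (Submodule.mem_span_singleton_self _)

/-! ### Stäckel systems and the dimension count -/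

namespace IsStaeckelSystem

theorem isSymmetricTensorField (hS : IsStaeckelSystem S) (hT : T ∈ withMetric S) :
    IsSymmetricTensorField T := by
  obtain ⟨K, hK, t, rfl⟩ := mem_withMetric.mp hT
  exact (hS.killing K hK).toIsSymmetricTensorField.add_smul isSymmetricTensorField_metric t

theorem exists_represents (hS : IsStaeckelSystem S) (hT : T ∈ withMetric S) :
    ∃ c : Coeffs, c.Represents T := by
  obtain ⟨K, hK, t, rfl⟩ := mem_withMetric.mp hT
  obtain ⟨c, hc⟩ := (hS.killing K hK).exists_represents
  exact ⟨_, hc.add (represents_metric.smul t)⟩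

theorem coeffs_integrable (hS : IsStaeckelSystem S) (hT : T ∈ withMetric S) {c : Coeffs}
    (hc : c.Represents T) : c.Integrable := by
  obtain ⟨K, hK, t, rfl⟩ := mem_withMetric.mp hT
  exact hc.integrable_of_add_smul_metric (hS.killing K hK).toIsSymmetricTensorField
    (hS.integrable K hK)

theorem commute_withMetric (hS : IsStaeckelSystem S) (hT : T ∈ withMetric S)
    (hT' : T' ∈ withMetric S) (x : S3) : T x ∘L T' x = T' x ∘L T x := by
  obtain ⟨K, hK, t, rfl⟩ := mem_withMetric.mp hT
  obtain ⟨K', hK', t', rfl⟩ := mem_withMetric.mp hT'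
  have h := (hS.killing K hK).toIsSymmetricTensorField
  have h' := (hS.killing K' hK').toIsSymmetricTensorField
  have hm := isSymmetricTensorField_metric
  simp only [Pi.add_apply, Pi.smul_apply, ContinuousLinearMap.add_comp,
    ContinuousLinearMap.comp_add, ContinuousLinearMap.smul_comp, ContinuousLinearMap.comp_smul,
    h.comp_metric, h.metric_comp, h'.comp_metric, h'.metric_comp, hm.comp_metric,
    hS.commute K hK K' hK']
  module

theorem exists_weyl_eq_zero (hS : IsStaeckelSystem S) (hT : T ∈ withMetric S)
    (hT' : T' ∈ withMetric S) :
    ∃ a b : ℝ, (a ≠ 0 ∨ b ≠ 0) ∧ a • weyl T + b • weyl T' = 0 := by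
  obtain ⟨c, hc⟩ := hS.exists_represents hT
  obtain ⟨c', hc'⟩ := hS.exists_represents hT'
  obtain ⟨a, b, hab, h⟩ := exists_traceFree_eq_zero
    (fun a b => hS.coeffs_integrable (add_mem (Submodule.smul_mem _ a hT)
      (Submodule.smul_mem _ b hT')) ((hc.smul a).add (hc'.smul b)))
    (hc.commuting hc' (hS.isSymmetricTensorField hT) (hS.isSymmetricTensorField hT')
      (hS.commute_withMetric hT hT'))
  refine ⟨a, b, hab, ?_⟩
  rw [hc.weyl_eq, hc'.weyl_eq, smul_comm a, smul_comm b, ← smul_add, ← map_smul, ← map_smul,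
    ← map_add, h, smul_zero]

theorem exists_eq_ofEndo (hS : IsStaeckelSystem S) (hT : T ∈ withMetric S) (hw : weyl T = 0) :
    ∃ A : V →L[ℝ] V, (∀ v w, ⟪A v, w⟫_ℝ = ⟪v, A w⟫_ℝ) ∧ T = ofEndo A := by
  obtain ⟨c, hc⟩ := hS.exists_represents hT
  exact hc.exists_eq_ofEndo (hS.coeffs_integrable hT hc) hw

theorem eq_smul_metric_or_exists_eq (hS : IsStaeckelSystem S) (hT : T ∈ withMetric S)
    (hw : weyl T = 0) (hT' : T' ∈ withMetric S) (hw' : weyl T' = 0) :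
    (∃ s : ℝ, T = s • metric) ∨ ∃ r s : ℝ, T' = r • T + s • metric := by
  have hcomm := hS.commute_withMetric hT hT'
  obtain ⟨A, hA, rfl⟩ := hS.exists_eq_ofEndo hT hw
  obtain ⟨A', hA', rfl⟩ := hS.exists_eq_ofEndo hT' hw'
  refine (eq_smul_id_or_exists_eq_smul_add hA hA' hcomm).imp ?_ ?_
  · rintro ⟨s, rfl⟩
    exact ⟨2 * s, ofEndo_smul_id s⟩
  · rintro ⟨r, s, rfl⟩
    exact ⟨r, 2 * s, ofEndo_smul_add r s A⟩

theorem finiteDimensional (hS : IsStaeckelSystem S) : FiniteDimensional ℝ S :=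
  FiniteDimensional.of_finrank_pos (by rw [hS.dim]; norm_num)

theorem finrank_range_weyl_le_one (hS : IsStaeckelSystem S) :
    Module.finrank ℝ (LinearMap.range (weyl.domRestrict (withMetric S))) ≤ 1 := by
  by_cases h : ∃ T : withMetric S, weyl T ≠ 0
  · obtain ⟨T, hT⟩ := h
    refine finrank_le_one ⟨weyl T, T, rfl⟩ ?_
    rintro ⟨_, T', rfl⟩
    obtain ⟨a, b, hab, h⟩ := hS.exists_weyl_eq_zero T.2 T'.2
    have hb : b ≠ 0 := by
      rintro rfl
      rw [zero_smul, add_zero] at h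
      exact hT ((smul_eq_zero.mp h).resolve_left (hab.resolve_right (by simp)))
    refine ⟨-(b⁻¹ * a), Subtype.ext ?_⟩
    change -(b⁻¹ * a) • weyl T = weyl T'
    rw [neg_smul, mul_smul, eq_neg_of_add_eq_zero_left h, smul_neg, neg_neg,
      inv_smul_smul₀ hb]
  · push Not at h
    refine finrank_le_one 0 ?_
    rintro ⟨_, T', rfl⟩
    exact ⟨0, Subtype.ext (by simpa using (h T').symm)⟩

theorem weyl_metric : weyl metric = 0 := by
  rw [represents_metric.weyl_eq, metricCoeffs, map_smul, traceFree_one, smul_zero, smul_zero]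

/-- A field without Weyl part that is not a multiple of the metric spans, together with the metric,
all of them, and they belong to the given system. -/
theorem exists_generator (hS : IsStaeckelSystem S) :
    ∃ K ∈ S, weyl K = 0 ∧ (∀ t : ℝ, K ≠ t • metric) ∧ metric ∈ S := by
  classical
  have := hS.finiteDimensional
  have : FiniteDimensional ℝ (withMetric S) := Submodule.finiteDimensional_sup _ _
  have hle : S ≤ withMetric S := le_sup_left
  let k := weyl.domRestrict (withMetric S)
  have hrank := LinearMap.finrank_range_add_finrank_ker (K := ℝ) (V := withMetric S) (V₂ := M3) k
  have h1 : Module.finrank ℝ (LinearMap.range k) ≤ 1 := hS.finrank_range_weyl_le_one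
  have h2 := Submodule.finrank_mono hle
  rw [hS.dim] at h2
  let g : withMetric S := ⟨metric, metric_mem_withMetric⟩
  -- The kernel of the Weyl map has dimension at least `3 - 1 = 2`, so it exceeds the line of the
  -- metric.
  obtain ⟨K, hK, hKg⟩ : ∃ K ∈ LinearMap.ker k, K ∉ Submodule.span ℝ {g} := by
    by_contra! h
    have h3 := (Submodule.finrank_mono (show LinearMap.ker k ≤ Submodule.span ℝ {g} from h)).trans
      (finrank_span_le_card {g})
    simp only [Set.toFinset_singleton, Finset.card_singleton] at h3
    omega
  have hKm : ∀ t : ℝ, (K : Field) ≠ t • metric := fun t ht =>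
    hKg (Submodule.mem_span_singleton.mpr ⟨t, Subtype.ext ht.symm⟩)
  have h4 : LinearMap.ker k ≤ Submodule.span ℝ (({K, g} : Finset (withMetric S)) : Set _) := by
    intro K' hK'
    obtain ⟨t, ht⟩ | ⟨r, s, h⟩ := hS.eq_smul_metric_or_exists_eq K.2 hK K'.2 hK'
    · exact absurd ht (hKm t)
    · simp only [Finset.coe_insert, Finset.coe_singleton, Submodule.mem_span_pair]
      exact ⟨r, s, Subtype.ext h.symm⟩
  have h5 := (Submodule.finrank_mono h4).trans (finrank_span_finset_le_card _)
  have h6 := h5.trans Finset.card_le_two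
  -- Rank at most one and kernel of dimension at most two bound the enlarged space by three, the
  -- dimension of `S`.
  have h7 : S = withMetric S := Submodule.eq_of_le_of_finrank_le hle (by rw [hS.dim]; omega)
  exact ⟨K, h7.ge K.2, hK, hKm, h7.ge metric_mem_withMetric⟩

theorem isSpecialKillingTensor (hS : IsStaeckelSystem S) (hT : T ∈ S) (hw : weyl T = 0) :
    IsSpecialKillingTensor T := by
  have hK := hS.killing T hT
  obtain ⟨A, hA, rfl⟩ := hS.exists_eq_ofEndo (Submodule.mem_sup_left hT) hw
  exact isSpecialKillingTensor_ofEndo hA hK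

end IsStaeckelSystem

end

end RoundSphere

end

theorem corollary7 (S : Submodule ℝ RoundSphere.Field) (hS : RoundSphere.IsStaeckelSystem S) :
    ∃ K ∈ S, RoundSphere.IsSpecialKillingTensor K ∧
      (∀ c : ℝ, K ≠ c • RoundSphere.metric) ∧
      ∀ K' : RoundSphere.Field, (K' ∈ S ∧ RoundSphere.IsSpecialKillingTensor K') ↔
        ∃ a b : ℝ, K' = a • K + b • RoundSphere.metric := by
  obtain ⟨K, hK, hw, hne, hg⟩ := hS.exists_generator
  have hle : S ≤ RoundSphere.withMetric S := le_sup_left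
  refine ⟨K, hK, hS.isSpecialKillingTensor hK hw, hne, fun K' => ⟨?_, ?_⟩⟩
  · rintro ⟨hK', hs⟩
    refine (hS.eq_smul_metric_or_exists_eq (hle hK) hw (hle hK') hs.weyl_eq_zero).resolve_left ?_
    rintro ⟨s, h⟩
    exact hne s h
  · rintro ⟨a, b, rfl⟩
    have hmem := add_mem (S.smul_mem a hK) (S.smul_mem b hg)
    refine ⟨hmem, hS.isSpecialKillingTensor hmem ?_⟩
    rw [map_add, map_smul, map_smul, hw, RoundSphere.IsStaeckelSystem.weyl_metric, smul_zero,
      smul_zero, add_zero]
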